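/- For a connected (multi)graph $G$ and an edge $e$ of $G$, let $\tau_G(e)$ be the number of spanning trees of $G$ that contain $e$. Given graphs $G_1,\dots,G_n$ with a chosen edge $e_i=u_iv_i$ in each $G_i$, the necklace graph $N(G_1,\dots,G_n)$ is obtained from the disjoint union of the $G_i$ by identifying $v_i$ with $u_{i+1}$ for every $i$ (indices modulo $n$), all edges being kept (for $n=2$ the edges $e_1,e_2$ become parallel). The edges $e_i$ are the key edges; a non-key edge that is adjacent to (shares an end-vertex with) a key edge is a type 1 edge; every other non-key edge is a type 2 edge. **Theorem.** Let $G=N(K_{r_1,s_1},K_{r_2,s_2},\dots,K_{r_n,s_n})$ with $r_1=s_1=1$ and $r_i,s_i\ge 1$ for $2\le i\le n$, where $K_{r_i,s_i}$ is the complete bipartite graph with parts $X_i,Y_i$, $|X_i|=r_i$, $|Y_i|=s_i$, and $u_i\in X_i$, $v_i\in Y_i$. Let $xy\in E(K_{r_k,s_k})$. If $xy$ is a type 1 edge of $G$, then exactly one of $\{x,y\}\cap\{u_k,v_k\}=\{u_k\}$ and $\{x,y\}\cap\{u_k,v_k\}=\{v_k\}$ holds, and $$\tau_G(xy)=\begin{cases}\displaystyle\prod_{i=1}^n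 r_i^{s_i-1}s_i^{r_i-1}\left[\frac{r_k+s_k-1}{r_ks_k}\sum_{i=1}^n\frac{r_i+s_i-1}{r_is_i}-\frac{(r_k-1)^2}{r_k^2s_k^2}\right],&\{x,y\}\cap\{u_k,v_k\}=\{u_k\},\\[2ex]\displaystyle\prod_{i=1}^n r_i^{s_i-1}s_i^{r_i-1}\left[\frac{r_k+s_k-1}{r_ks_k}\sum_{i=1}^n\frac{r_i+s_i-1}{r_is_i}-\frac{(s_k-1)^2}{r_k^2s_k^2}\right],&\{x,y\}\cap\{u_k,v_k\}=\{v_k\}.\end{cases}$$ If $xy$ is a type 2 edge of $G$, then $$\tau_G(xy)=\prod_{i=1}^n r_i^{s_i-1}s_i^{r_i-1}\left[\frac{r_k+s_k-1}{r_ks_k}\sum_{i=1}^n\frac{r_i+s_i-1}{r_is_i}-\frac{1}{r_k^2s_k^2}\right].$$ -/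

import Mathlib

open scoped Graph

/-! Multigraphs are Mathlib's `Graph α β` (vertices in `α`, edges in `β`); spanning subgraphs are
Mathlib's `H ≤s G`. -/

namespace Graph

/-- A multigraph is a tree if it has no loops and no parallel edges (these are its cycles of
length one and two) and the underlying simple graph on its vertex set is a tree. -/
def IsTree {α β : Type*} (T : Graph α β) : Prop :=
  T.Simple ∧ T.toSimpleGraph.IsTree

/-- `τ_G(e)`: the number of spanning trees of `G` that contain the edge `e`. -/
noncomputable def numSpanningTreesThrough {α β : Type*} (G : Graph α β) (e : β) : ℕ :=
  {T : Graph α β | T ≤s G ∧ T.IsTree ∧ e ∈ E(T)}.ncard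

/-- Two distinct edges are adjacent if they share an end-vertex. -/
def EdgeAdj {α β : Type*} (G : Graph α β) (e f : β) : Prop :=
  e ≠ f ∧ ∃ w, G.Inc e w ∧ G.Inc f w

/-- The disjoint union of a family of multigraphs. -/
def disjointUnion {ι : Type*} {α β : ι → Type*} (G : ∀ i, Graph (α i) (β i)) :
    Graph (Σ i, α i) (Σ i, β i) where
  vertexSet := {p | p.2 ∈ V(G p.1)}
  IsLink e p q := ∃ a b, (G e.1).IsLink e.2 a b ∧ p = ⟨e.1, a⟩ ∧ q = ⟨e.1, b⟩
  isLink_symm := by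
    rintro e -
    exact ⟨fun p q ⟨a, b, h, hp, hq⟩ => ⟨b, a, h.symm, hq, hp⟩⟩
  eq_or_eq_of_isLink_of_isLink := by
    rintro e p q p' q' ⟨a, b, h, rfl, rfl⟩ ⟨a', b', h', rfl, rfl⟩
    obtain rfl | rfl := h.left_eq_or_eq h'
    · exact Or.inl rfl
    · exact Or.inr rfl
  left_mem_of_isLink := by
    rintro e p q ⟨a, b, h, rfl, rfl⟩
    exact h.left_mem

end Graph

namespace Necklace

variable {n : ℕ} [NeZero n] {α β : Fin n → Type*}

/-- The identification `v_i ∼ u_{i+1}`, the indices being taken modulo `n`. -/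
def Glue (u v : ∀ i, α i) (p q : Σ i, α i) : Prop :=
  ∃ i : Fin n, p = ⟨i, v i⟩ ∧ q = ⟨i + 1, u (i + 1)⟩

/-- The necklace graph `N(G_1, …, G_n)` with key vertices `u_i`, `v_i`: the disjoint union of the
`G_i`, in which `v_i` and `u_{i+1}` are identified (`Quot` passes to the generated equivalence
relation). All edges are kept, as a multigraph. -/
def necklace (G : ∀ i, Graph (α i) (β i)) (u v : ∀ i, α i) :
    Graph (Quot (Glue u v)) (Σ i, β i) :=
  (Graph.disjointUnion G).map (Quot.mk (Glue u v))

/-- The key edges, given the chosen edge `e_i` of each `G_i`. -/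
def IsKeyEdge (e : ∀ i, β i) (f : Σ i, β i) : Prop :=
  ∃ i, f = ⟨i, e i⟩

/-- Type 1 edges: the non-key edges that are adjacent to a key edge. -/
def IsTypeOne (G : ∀ i, Graph (α i) (β i)) (u v : ∀ i, α i) (e : ∀ i, β i)
    (f : Σ i, β i) : Prop :=
  f ∈ E(necklace G u v) ∧ ¬ IsKeyEdge e f ∧
    ∃ g, IsKeyEdge e g ∧ (necklace G u v).EdgeAdj f g

/-- Type 2 edges: the edges that are neither key edges nor type 1 edges. -/
def IsTypeTwo (G : ∀ i, Graph (α i) (β i)) (u v : ∀ i, α i) (e : ∀ i, β i)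
    (f : Σ i, β i) : Prop :=
  f ∈ E(necklace G u v) ∧ ¬ IsKeyEdge e f ∧ ¬ IsTypeOne G u v e f

/-- The complete bipartite graph `K_{r,s}`, with parts `X = Fin r` and `Y = Fin s`. -/
abbrev K (r s : ℕ) : Graph (Fin r ⊕ Fin s) (Sym2 (Fin r ⊕ Fin s)) :=
  Graph.ofSimpleGraph (completeBipartiteGraph (Fin r) (Fin s))

end Necklace

/-!
The spanning trees of the necklace are counted bead by bead, and the counts inside one complete
bipartite bead are determinants.

*Necklace.* A set of edges of the necklace is the edge set of a spanning tree exactly when it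
restricts to a spanning tree in every bead except one, and in that bead to a spanning forest with
two components that separate the key vertices `u i`, `v i` (`Necklace.isTreeSet_necklace_iff`).
A connected edge set cannot separate the key vertices of two beads, since the two would form a cut
(`Necklace.not_connects_of_two_cuts`), and the number of edges then leaves exactly one separated
bead. Adding the key edge `e i` turns the separating forests of a bead into its spanning trees
through `e i` (`Graph.ncard_isSplitSet`). Write `P i` for the number of spanning trees of the
`i`-th bead, `P i * D i` for the number of those through a given edge, and `P k * M` for the number
of those of the `k`-th bead through both its key edge and the edge `f`. Summing over the separated
bead, the number of spanning trees through `f` is `∏ P i * (D k * ∑ D i - (D k ^ 2 - M))`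
(`Necklace.numSpanningTreesThrough_of_ncard`).

*Complete bipartite beads.* For a tree `F₀` on a vertex set `R`, the spanning trees containing `F₀`
correspond to the maps sending each vertex off `R` to a neighbour in such a way that iteration leads
to `R` (`RootedForest.bijOn_treeOf`). By the directed matrix-tree theorem
(`RootedForest.sum_isRooted_eq_det`) their number is a Laplacian determinant: expanding it by rows
gives a sum over all parent maps, in which a rooted map contributes one (its matrix is unitriangular)
and any other map contributes zero (its matrix has a kernel). For `K r s` the Schur complement of
this Laplacian is a rank-one perturbation of a scalar matrix, so all the determinants are explicit.
The sets `R` needed are a single vertex for `P`, the ends of the edge for `P * D`, and the three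
ends of two edges that meet. For two disjoint edges `R` consists of the ends of the key edge, and
the parent of one end of the other edge is prescribed to be the other end, in both ways.
-/

/-! ### Spanning trees as edge sets -/

namespace Graph

variable {α β : Type*}

/-- `p` and `q` are joined by a walk all of whose edges are in `F`. -/
def Joined (G : Graph α β) (F : Set β) : α → α → Prop :=
  Relation.EqvGen fun p q => ∃ e ∈ F, G.IsLink e p q

/-- The edge set `F` of `G` joins all vertices to each other (the vertices being all of `α`). -/
def Connects (G : Graph α β) (F : Set β) : Prop :=
  ∀ p q, G.Joined F p q

/-- Being joined is the least equivalence relation that relates the ends of each edge in `F`. -/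
lemma Joined.mono_rel {G : Graph α β} {F : Set β} {r : α → α → Prop} (hr : Equivalence r)
    (h : ∀ e ∈ F, ∀ p q, G.IsLink e p q → r p q) {p q : α} (hpq : G.Joined F p q) : r p q := by
  induction hpq with
  | rel p q hl => exact h _ hl.choose_spec.1 _ _ hl.choose_spec.2
  | refl p => exact hr.refl p
  | symm _ _ _ ih => exact hr.symm ih
  | trans _ _ _ _ _ ih1 ih2 => exact hr.trans ih1 ih2

lemma joined_equivalence (G : Graph α β) (F : Set β) : Equivalence (G.Joined F) :=
  ⟨.refl, .symm _ _, .trans _ _ _⟩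

lemma Joined.apply_eq {γ : Sort*} {G : Graph α β} {F : Set β} (c : α → γ)
    (h : ∀ e ∈ F, ∀ p q, G.IsLink e p q → c p = c q) {p q : α} (hpq : G.Joined F p q) :
    c p = c q :=
  hpq.mono_rel (r := fun p q => c p = c q) ⟨fun _ => rfl, .symm, .trans⟩ h

lemma IsLink.joined {G : Graph α β} {F : Set β} {e : β} {p q : α} (h : G.IsLink e p q)
    (he : e ∈ F) : G.Joined F p q :=
  .rel _ _ ⟨e, he, h⟩

/-- The edge set of a spanning tree, in the counting form: it joins all vertices, and has one
edge less than there are vertices. -/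
def IsTreeSet (G : Graph α β) (F : Set β) : Prop :=
  F ⊆ E(G) ∧ G.Connects F ∧ F.ncard + 1 = Nat.card α

/-- The simple graph on `α` in which distinct vertices are adjacent when an edge in `F` links
them. -/
def linkGraph (G : Graph α β) (F : Set β) : SimpleGraph α where
  Adj p q := p ≠ q ∧ ∃ e ∈ F, G.IsLink e p q
  symm := ⟨fun _ _ ⟨h, e, he, hl⟩ => ⟨h.symm, e, he, hl.symm⟩⟩

lemma linkGraph_connected_iff [Nonempty α] {G : Graph α β} {F : Set β} :
    (G.linkGraph F).Connected ↔ G.Connects F := by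
  constructor
  · intro h p q
    obtain ⟨w⟩ := h.preconnected p q
    induction w with
    | nil => exact .refl _
    | cons hadj _ ih => exact .trans _ _ _ (.rel _ _ hadj.2) ih
  · intro h
    refine ⟨fun p q => ?_⟩
    induction h p q with
    | rel p q hl =>
      by_cases hpq : p = q
      · rw [hpq]
      · exact SimpleGraph.Adj.reachable (G := G.linkGraph F) ⟨hpq, hl⟩
    | refl => exact .refl _
    | symm _ _ _ ih => exact ih.symm
    | trans _ _ _ _ _ ih1 ih2 => exact ih1.trans ih2

/-- An edge of `linkGraph` determines an edge in `F` with the same pair of ends. -/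
lemma exists_edge_of_mem_linkGraph {G : Graph α β} {F : Set β}
    (e : (G.linkGraph F).edgeSet) : ∃ f : F, ∀ p q, e.1 = s(p, q) ↔ G.IsLink f p q := by
  obtain ⟨e, he⟩ := e
  induction e with
  | h a b =>
    obtain ⟨hab, f, hf, hl⟩ := (SimpleGraph.mem_edgeSet _).1 he
    exact ⟨⟨f, hf⟩, fun p q => (hl.isLink_iff_sym2_eq).symm⟩

/-- A choice of an edge in `F` for each edge of `linkGraph`. -/
noncomputable def liftEdge (G : Graph α β) (F : Set β) (e : (G.linkGraph F).edgeSet) : F :=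
  (exists_edge_of_mem_linkGraph e).choose

lemma eq_mk_iff_isLink_liftEdge {G : Graph α β} {F : Set β} (e : (G.linkGraph F).edgeSet)
    (p q : α) : e.1 = s(p, q) ↔ G.IsLink (G.liftEdge F e) p q :=
  (exists_edge_of_mem_linkGraph e).choose_spec p q

lemma liftEdge_injective (G : Graph α β) (F : Set β) : (G.liftEdge F).Injective := by
  intro e e' h
  apply Subtype.ext
  obtain ⟨e1, he1⟩ := e
  induction e1 with
  | h a b =>
    have := (eq_mk_iff_isLink_liftEdge ⟨s(a, b), he1⟩ a b).1 rfl
    rw [h, ← eq_mk_iff_isLink_liftEdge] at this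
    exact this.symm

/-- A connected multigraph has at most one vertex more than it has edges. -/
lemma Connects.card_le [Finite α] [Nonempty α] [Finite β] {G : Graph α β} {F : Set β}
    (h : G.Connects F) : Nat.card α ≤ F.ncard + 1 := by
  have h1 := (linkGraph_connected_iff.2 h).card_vert_le_card_edgeSet_add_one
  have h2 := Nat.card_le_card_of_injective _ (liftEdge_injective G F)
  rw [Nat.card_coe_set_eq F] at h2
  omega

/-- A multigraph on all of `α` is a tree exactly when its edges join all vertices and number one
less than the vertices: the underlying simple graph then needs all the edges, which excludes loops
and parallel edges. -/
lemma isTree_iff_isTreeSet [Finite α] [Nonempty α] [Finite β] {T : Graph α β}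
    (hV : V(T) = Set.univ) : T.IsTree ↔ T.IsTreeSet E(T) := by
  have iso : T.toSimpleGraph ≃g T.linkGraph E(T) :=
    { toEquiv := Equiv.subtypeUnivEquiv (fun x => by simp [hV])
      map_rel_iff' := by
        rintro ⟨a, ha⟩ ⟨b, hb⟩
        simp only [linkGraph, Equiv.subtypeUnivEquiv_apply, toSimpleGraph_adj, Ne, Subtype.mk.injEq,
          Adj]
        exact and_congr_right fun _ => ⟨fun ⟨e, _, h⟩ => ⟨e, h⟩, fun ⟨e, h⟩ => ⟨e, h.edge_mem, h⟩⟩ }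
  rw [IsTree, iso.isTree_iff, SimpleGraph.isTree_iff_connected_and_card, linkGraph_connected_iff,
    IsTreeSet]
  refine ⟨fun ⟨hs, hc, hn⟩ => ⟨subset_rfl, hc, ?_⟩, fun ⟨_, hc, hn⟩ => ?_⟩
  · rw [← hn, ← Nat.card_coe_set_eq E(T)]
    congr 1
    refine (Nat.card_eq_of_bijective _ ⟨liftEdge_injective T E(T), fun ⟨f, hf⟩ => ?_⟩).symm
    obtain ⟨p, q, hl⟩ := exists_isLink_of_mem_edgeSet hf
    refine ⟨⟨s(p, q), hl.ne, f, hf, hl⟩, Subtype.ext ?_⟩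
    exact ((eq_mk_iff_isLink_liftEdge (G := T) (F := E(T))
      ⟨s(p, q), hl.ne, f, hf, hl⟩ p q).1 rfl).eq hl
  -- The count makes `liftEdge` a bijection, so no edge is a loop or has a parallel edge.
  · have h1 := (linkGraph_connected_iff.2 hc).card_vert_le_card_edgeSet_add_one
    have h2 := Nat.card_le_card_of_injective _ (liftEdge_injective T E(T))
    rw [Nat.card_coe_set_eq E(T)] at h2
    have hcard : Nat.card (T.linkGraph E(T)).edgeSet = Nat.card E(T) := by
      rw [Nat.card_coe_set_eq E(T)]; omega
    have hbij := (Nat.bijective_iff_injective_and_card _).2 ⟨liftEdge_injective T E(T), hcard⟩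
    have hlift : ∀ e p q, T.IsLink e p q →
        ∃ g : (T.linkGraph E(T)).edgeSet, g.1 = s(p, q) ∧ (T.liftEdge E(T) g).1 = e := by
      intro e p q hl
      obtain ⟨g, hg⟩ := hbij.2 ⟨e, hl.edge_mem⟩
      refine ⟨g, (eq_mk_iff_isLink_liftEdge g p q).2 ?_, by rw [hg]⟩
      rw [hg]
      exact hl
    refine ⟨{ not_isLoopAt := ?_, eq_of_isLink := ?_ }, hc, by omega⟩
    · intro e x hl
      obtain ⟨⟨g, hg⟩, h, -⟩ := hlift e x x hl
      simp only at h
      subst h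
      exact hg.1 rfl
    · intro e f x y he hf
      obtain ⟨g, hg, rfl⟩ := hlift e x y he
      obtain ⟨g', hg', rfl⟩ := hlift f x y hf
      rw [Subtype.ext (hg.trans hg'.symm)]

/-- A spanning tree is determined by its edge set. -/
lemma numSpanningTreesThrough_eq [Finite α] [Nonempty α] [Finite β] {G : Graph α β}
    (hV : V(G) = Set.univ) (e : β) :
    G.numSpanningTreesThrough e = {F | G.IsTreeSet F ∧ e ∈ F}.ncard := by
  have key : ∀ T : Graph α β, T ≤s G → (T.IsTree ↔ G.IsTreeSet E(T)) := by
    intro T hT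
    rw [isTree_iff_isTreeSet (hT.vertexSet_eq.trans hV)]
    have : (fun p q => ∃ e ∈ E(T), T.IsLink e p q) = fun p q => ∃ e ∈ E(T), G.IsLink e p q := by
      ext p q
      exact exists_congr fun e => and_congr_right fun he => hT.le.isLink_iff he
    simp only [IsTreeSet, Connects, Joined, this, subset_rfl, hT.le.edgeSet_mono, true_and]
  refine Set.ncard_congr (fun T _ => E(T)) ?_ ?_ ?_
  · rintro T ⟨hT, hT', he⟩
    exact ⟨(key T hT).1 hT', he⟩
  · rintro T T' ⟨hT, -⟩ ⟨hT', -⟩ h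
    exact Graph.Compatible.ext (hT.vertexSet_eq.trans hT'.vertexSet_eq.symm) h
      (.of_le_le hT.le hT'.le)
  · rintro F ⟨hF, he⟩
    have hE : E(G.restrict F) = F := by
      simp [hF.1]
    have hs : G.restrict F ≤s G := ⟨restrict_le, rfl⟩
    exact ⟨G.restrict F, ⟨hs, (key _ hs).2 (hE.symm ▸ hF), hE.symm ▸ he⟩, hE⟩

end Graph

/-! ### Spanning trees of a necklace -/

namespace Graph

variable {α β : Type*}

/-- The edge set of a spanning forest with two components that are separated by the edge `e`,
in the counting form: `F` joins all vertices when `e` is added to it, and has two edges less than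
there are vertices. -/
def IsSplitSet (G : Graph α β) (e : β) (F : Set β) : Prop :=
  F ⊆ E(G) ∧ G.Connects (insert e F) ∧ F.ncard + 2 = Nat.card α

lemma IsSplitSet.not_connects [Finite α] [Nonempty α] [Finite β] {G : Graph α β} {e : β}
    {F : Set β} (h : G.IsSplitSet e F) : ¬ G.Connects F := fun hc => by
  have := hc.card_le
  have := h.2.2
  omega

lemma IsSplitSet.notMem [Finite α] [Nonempty α] [Finite β] {G : Graph α β} {e : β}
    {F : Set β} (h : G.IsSplitSet e F) : e ∉ F := fun he =>
  h.not_connects (by simpa [Set.insert_eq_of_mem he] using h.2.1)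

/-- Adding `e` is a bijection from the two-component forests separated by `e` to the spanning
trees through `e`. -/
lemma ncard_isSplitSet [Finite α] [Nonempty α] [Finite β] {G : Graph α β} {e : β}
    (he : e ∈ E(G)) (p : Set β → Prop) (hp : ∀ F, p (insert e F) ↔ p F) :
    {F | G.IsSplitSet e F ∧ p F}.ncard = {F | G.IsTreeSet F ∧ e ∈ F ∧ p F}.ncard := by
  refine Set.ncard_congr (fun F _ => insert e F) ?_ ?_ ?_
  · rintro F ⟨hF, hpF⟩
    refine ⟨⟨Set.insert_subset he hF.1, hF.2.1, ?_⟩, Set.mem_insert _ _, (hp F).2 hpF⟩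
    rw [Set.ncard_insert_of_notMem hF.notMem]
    exact hF.2.2
  · rintro F F' ⟨hF, -⟩ ⟨hF', -⟩ h
    rw [← Set.insert_sdiff_self_of_notMem hF.notMem, h,
      Set.insert_sdiff_self_of_notMem hF'.notMem]
  · rintro F ⟨hF, heF, hpF⟩
    have hins : insert e (F \ {e}) = F := by simp [Set.insert_eq_of_mem heF]
    refine ⟨F \ {e}, ⟨⟨Set.sdiff_subset.trans hF.1, hins.symm ▸ hF.2.1, ?_⟩, ?_⟩, hins⟩
    · rw [← hF.2.2, ← Set.ncard_sdiff_singleton_add_one heF]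
    · rwa [← hp, hins]

end Graph

namespace Necklace

open Graph

/-- The edges of `F` in the `i`-th bead. -/
def bead {n : ℕ} {β : Fin n → Type*} (F : Set (Σ i, β i)) (i : Fin n) : Set (β i) := {f | ⟨i, f⟩ ∈ F}

lemma ncard_eq_sum_bead {n : ℕ} {β : Fin n → Type*} [∀ i, Finite (β i)] (F : Set (Σ i, β i)) :
    F.ncard = ∑ i, (bead F i).ncard := by
  simp only [← Nat.card_coe_set_eq]
  rw [← Nat.card_sigma]
  exact Nat.card_congr
    { toFun := fun x => ⟨x.1.1, x.1.2, x.2⟩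
      invFun := fun x => ⟨⟨x.1, x.2.1⟩, x.2.2⟩
      left_inv := fun _ => rfl
      right_inv := fun _ => rfl }

variable {n : ℕ} [NeZero n] {α β : Fin n → Type*}
variable {G : ∀ i, Graph (α i) (β i)} {u v : ∀ i, α i}

lemma val_add_one_mod (m : Fin n) : (m + 1).val = (m.val + 1) % n := by
  rw [Fin.val_add, Fin.coe_ofNat_eq_mod, Nat.add_mod_mod]

lemma glue_eq (i : Fin n) :
    Quot.mk (Glue u v) ⟨i, v i⟩ = Quot.mk (Glue u v) ⟨i + 1, u (i + 1)⟩ :=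
  Quot.sound ⟨i, rfl, rfl⟩

lemma necklace_isLink {i : Fin n} {f : β i} {a b : α i} (h : (G i).IsLink f a b) :
    (necklace G u v).IsLink ⟨i, f⟩ (Quot.mk _ ⟨i, a⟩) (Quot.mk _ ⟨i, b⟩) :=
  Graph.IsLink.map (G := disjointUnion G) (Quot.mk (Glue u v)) ⟨a, b, h, rfl, rfl⟩

lemma exists_of_necklace_isLink {e : Σ i, β i} {p q : Quot (Glue u v)}
    (h : (necklace G u v).IsLink e p q) : ∃ a b, (G e.1).IsLink e.2 a b ∧
      p = Quot.mk _ ⟨e.1, a⟩ ∧ q = Quot.mk _ ⟨e.1, b⟩ := by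
  obtain ⟨x, y, ⟨a, b, hl, rfl, rfl⟩, rfl, rfl⟩ := h
  exact ⟨a, b, hl, rfl, rfl⟩

lemma mem_edgeSet_necklace {e : Σ i, β i} :
    e ∈ E(necklace G u v) ↔ e.2 ∈ E(G e.1) := by
  constructor
  · intro h
    obtain ⟨p, q, hl⟩ := exists_isLink_of_mem_edgeSet h
    obtain ⟨a, b, hl, -⟩ := exists_of_necklace_isLink hl
    exact hl.edge_mem
  · intro h
    obtain ⟨a, b, hl⟩ := exists_isLink_of_mem_edgeSet h
    exact (necklace_isLink (u := u) (v := v) hl).edge_mem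

lemma vertexSet_necklace (hV : ∀ i, V(G i) = Set.univ) : V(necklace G u v) = Set.univ := by
  ext p
  obtain ⟨⟨i, a⟩, rfl⟩ := Quot.exists_rep p
  simp only [Set.mem_univ, iff_true]
  exact ⟨⟨i, a⟩, by simp [disjointUnion, hV], rfl⟩

open Classical in
/-- Each vertex of the necklace has exactly one representative that is not of the form `v i`. -/
noncomputable def vertexEquiv (huv : ∀ i, u i ≠ v i) :
    Quot (Glue u v) ≃ Σ i, {a : α i // a ≠ v i} where
  toFun := Quot.lift
    (fun p => if h : p.2 = v p.1 then ⟨p.1 + 1, u (p.1 + 1), huv _⟩ else ⟨p.1, p.2, h⟩) (by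
      rintro _ _ ⟨i, rfl, rfl⟩
      simp [huv])
  invFun x := Quot.mk _ ⟨x.1, x.2⟩
  left_inv := by
    rintro ⟨i, a⟩
    by_cases h : a = v i
    · subst h
      change (fun x : Σ i, {a : α i // a ≠ v i} => Quot.mk (Glue u v) ⟨x.1, x.2.1⟩)
        (dite _ _ _) = _
      rw [dif_pos rfl]
      exact (glue_eq i).symm
    · change (fun x : Σ i, {a : α i // a ≠ v i} => Quot.mk (Glue u v) ⟨x.1, x.2.1⟩)
        (dite _ _ _) = _
      rw [dif_neg h]
  right_inv := by
    rintro ⟨i, a, h⟩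
    simp [h]

/-- The necklace has `n` vertices less than its beads have in total. -/
lemma card_vertex [∀ i, Finite (α i)] (huv : ∀ i, u i ≠ v i) :
    Nat.card (Quot (Glue u v)) + n = ∑ i, Nat.card (α i) := by
  classical
  have := fun i => Fintype.ofFinite (α i)
  have h1 : ∀ i, Nat.card (α i) = Nat.card {a : α i // a ≠ v i} + 1 := by
    intro i
    have := Fintype.card_pos_iff.2 ⟨v i⟩
    simp only [Nat.card_eq_fintype_card, Fintype.card_subtype_compl, ne_eq,
      Fintype.card_subtype_eq]
    omega
  rw [Nat.card_congr (vertexEquiv huv), Nat.card_sigma, Finset.sum_congr rfl fun i _ => h1 i,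
    Finset.sum_add_distrib]
  simp

lemma joined_necklace {F : Set (Σ i, β i)} {i : Fin n} {a b : α i}
    (h : (G i).Joined (bead F i) a b) :
    (necklace G u v).Joined F (Quot.mk _ ⟨i, a⟩) (Quot.mk _ ⟨i, b⟩) :=
  h.mono_rel ((joined_equivalence (necklace G u v) F).comap fun a => Quot.mk _ ⟨i, a⟩)
    fun _ he _ _ hl => (necklace_isLink hl).joined he

/-- Contracting all beads but the `i`-th identifies its two key vertices; joining them by the key
edge does the same. -/
lemma connects_insert_bead {F : Set (Σ i, β i)} (hF : (necklace G u v).Connects F) (i : Fin n)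
    {e : β i} (he : (G i).IsLink e (u i) (v i)) :
    (G i).Connects (insert e (bead F i)) := by
  classical
  let r : α i → α i → Prop := fun p q => ∃ f ∈ insert e (bead F i), (G i).IsLink f p q
  have huv : Quot.mk r (v i) = Quot.mk r (u i) :=
    Quot.sound ⟨e, Set.mem_insert _ _, he.symm⟩
  -- The contraction: every vertex outside the `i`-th bead goes to the class of its key vertices.
  let g : (Σ i, α i) → Quot r := fun p =>
    if h : p.1 = i then Quot.mk r (h ▸ p.2) else Quot.mk r (u i)
  have hgu : ∀ j, g ⟨j, u j⟩ = Quot.mk r (u i) := by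
    intro j
    by_cases h : j = i
    · subst h; simp [g]
    · simp [g, h]
  have hgv : ∀ j, g ⟨j, v j⟩ = Quot.mk r (u i) := by
    intro j
    by_cases h : j = i
    · subst h; simp [g, huv]
    · simp [g, h]
  let c : Quot (Glue u v) → Quot r := Quot.lift g (by
    rintro _ _ ⟨j, rfl, rfl⟩
    rw [hgu, hgv])
  have hc : ∀ f ∈ F, ∀ p q, (necklace G u v).IsLink f p q → c p = c q := by
    rintro ⟨j, f⟩ hf p q hl
    obtain ⟨a, b, hll, rfl, rfl⟩ := exists_of_necklace_isLink hl
    change g _ = g _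
    by_cases h : j = i
    · subst h
      simp only [g, dite_true]
      exact Quot.sound ⟨f, Set.mem_insert_of_mem _ hf, hll⟩
    · simp [g, h]
  intro p q
  have h := (hF (Quot.mk _ ⟨i, p⟩) (Quot.mk _ ⟨i, q⟩)).apply_eq c hc
  change g _ = g _ at h
  simp only [g, dite_true] at h
  exact Quot.eqvGen_exact h

/-- Two beads with separated key vertices leave a cut of the necklace: on one side lie the beads
strictly between them, together with the part of each of the two that hangs on these. -/
lemma not_connects_of_two_cuts {F : Set (Σ i, β i)} {i j : Fin n} (hij : i < j)
    (hi : ¬ (G i).Joined (bead F i) (u i) (v i)) (hj : ¬ (G j).Joined (bead F j) (u j) (v j)) :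
    ¬ (necklace G u v).Connects F := by
  intro hF
  let g : (Σ i, α i) → Prop := fun p =>
    (i < p.1 ∧ p.1 < j) ∨ (p.1 = i ∧ (G p.1).Joined (bead F p.1) p.2 (v p.1)) ∨
      (p.1 = j ∧ (G p.1).Joined (bead F p.1) p.2 (u p.1))
  have hgv : ∀ m, g ⟨m, v m⟩ ↔ i ≤ m ∧ m < j := by
    intro m
    simp only [g]
    constructor
    · rintro (h | ⟨rfl, -⟩ | ⟨rfl, h⟩)
      · exact ⟨h.1.le, h.2⟩
      · exact ⟨le_rfl, hij⟩
      · exact absurd (Relation.EqvGen.symm _ _ h) hj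
    · rintro ⟨h1, h2⟩
      rcases h1.eq_or_lt with rfl | h1
      · exact Or.inr (Or.inl ⟨rfl, .refl _⟩)
      · exact Or.inl ⟨h1, h2⟩
  have hgu : ∀ m, g ⟨m, u m⟩ ↔ i < m ∧ m ≤ j := by
    intro m
    simp only [g]
    constructor
    · rintro (h | ⟨rfl, h⟩ | ⟨rfl, h⟩)
      · exact ⟨h.1, h.2.le⟩
      · exact absurd h hi
      · exact ⟨hij, le_rfl⟩
    · rintro ⟨h1, h2⟩
      rcases h2.eq_or_lt with rfl | h2
      · exact Or.inr (Or.inr ⟨rfl, .refl _⟩)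
      · exact Or.inl ⟨h1, h2⟩
  let c : Quot (Glue u v) → Prop := Quot.lift g (by
    rintro _ _ ⟨m, rfl, rfl⟩
    rw [hgv, hgu, eq_iff_iff]
    simp only [Fin.lt_def, Fin.le_def, val_add_one_mod] at hij ⊢
    have hm := m.isLt
    have hj' := j.isLt
    by_cases h : m.1 + 1 = n
    · rw [h, Nat.mod_self]
      omega
    · rw [Nat.mod_eq_of_lt (by omega)]
      omega)
  have hc : ∀ f ∈ F, ∀ p q, (necklace G u v).IsLink f p q → c p = c q := by
    rintro ⟨m, f⟩ hf p q hl
    obtain ⟨a, b, hll, rfl, rfl⟩ := exists_of_necklace_isLink hl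
    change g _ = g _
    have hab : (G m).Joined (bead F m) a b := hll.joined hf
    have key : ∀ w, (G m).Joined (bead F m) a w ↔ (G m).Joined (bead F m) b w := fun w =>
      ⟨fun h => (hab.symm _ _).trans _ _ _ h, fun h => hab.trans _ _ _ h⟩
    simp only [g, key]
  have h := (hF (Quot.mk _ ⟨i, u i⟩) (Quot.mk _ ⟨i, v i⟩)).apply_eq c hc
  change g _ = g _ at h
  rw [eq_iff_iff, hgu, hgv] at h
  exact absurd (h.2 ⟨le_rfl, hij⟩).1 (lt_irrefl _)

/-- If every bead but the `i₀`-th is connected, the key vertices are joined by going around the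
necklace from `v i₀` to `u i₀`. -/
lemma joined_around {F : Set (Σ i, β i)} {i₀ : Fin n}
    (h : ∀ i, i ≠ i₀ → (G i).Connects (bead F i)) (j : Fin n) :
    (necklace G u v).Joined F (Quot.mk _ ⟨i₀, v i₀⟩) (Quot.mk _ ⟨j, u j⟩) := by
  have hn := i₀.isLt
  have succ : ∀ k, Fin.ofNat n k + 1 = Fin.ofNat n (k + 1) := by
    intro k
    apply Fin.ext
    rw [val_add_one_mod, Fin.val_ofNat, Fin.val_ofNat, Nat.mod_add_mod]
  -- Induction along the beads `i₀ + 1`, …, `i₀ + n = i₀`; only the last one is not crossed.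
  have key : ∀ t, t + 1 ≤ n → (necklace G u v).Joined F (Quot.mk _ ⟨i₀, v i₀⟩)
      (Quot.mk _ ⟨Fin.ofNat n (i₀ + (t + 1)), u (Fin.ofNat n (i₀ + (t + 1)))⟩) := by
    intro t
    induction t with
    | zero =>
      intro _
      have : Fin.ofNat n (i₀ + (0 + 1)) = i₀ + 1 := by
        rw [zero_add, ← succ]
        congr 1
        exact Fin.ext (Nat.mod_eq_of_lt hn)
      rw [this, ← glue_eq]
      exact .refl _
    | succ t ih =>
      intro ht
      refine .trans _ _ _ (ih (by omega)) ?_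
      have hne : Fin.ofNat n (i₀ + (t + 1)) ≠ i₀ := by
        intro heq
        have h1 := congrArg Fin.val heq
        simp only [Fin.val_ofNat] at h1
        by_cases hlt : i₀.1 + (t + 1) < n
        · rw [Nat.mod_eq_of_lt hlt] at h1
          omega
        · rw [Nat.mod_eq_sub_mod (by omega), Nat.mod_eq_of_lt (by omega)] at h1
          omega
      have hj := joined_necklace (u := u) (v := v)
        (h _ hne (u (Fin.ofNat n (i₀ + (t + 1)))) (v (Fin.ofNat n (i₀ + (t + 1)))))
      rwa [glue_eq, succ] at hj
  obtain ⟨t, ht, htj⟩ : ∃ t, t + 1 ≤ n ∧ Fin.ofNat n (i₀ + (t + 1)) = j := by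
    have hj := j.isLt
    by_cases hlt : i₀ < j
    · refine ⟨j - i₀ - 1, by omega, Fin.ext ?_⟩
      simp only [Fin.val_ofNat]
      rw [Nat.mod_eq_of_lt] <;> omega
    · refine ⟨j + n - i₀ - 1, by omega, Fin.ext ?_⟩
      simp only [Fin.val_ofNat]
      rw [Nat.mod_eq_sub_mod (by omega), Nat.mod_eq_of_lt] <;> omega
  exact htj ▸ key t ht

/-- Connected beads together with one bead that the key edge connects form a connected necklace:
the other beads take the place of that key edge. -/
lemma connects_necklace {F : Set (Σ i, β i)} {i₀ : Fin n} {e : β i₀}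
    (he : (G i₀).IsLink e (u i₀) (v i₀))
    (h : ∀ i, i ≠ i₀ → (G i).Connects (bead F i))
    (h₀ : (G i₀).Connects (insert e (bead F i₀))) : (necklace G u v).Connects F := by
  have base : ∀ p, (necklace G u v).Joined F (Quot.mk _ ⟨i₀, v i₀⟩) p := by
    intro p
    obtain ⟨⟨i, a⟩, rfl⟩ := Quot.exists_rep p
    refine .trans _ _ _ (joined_around h i) ?_
    by_cases hi : i = i₀
    · subst hi
      refine (h₀ (u i) a).mono_rel
        ((joined_equivalence (necklace G u v) F).comap fun a => Quot.mk _ ⟨i, a⟩) ?_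
      rintro f (rfl | hf) p q hl
      · have huv := joined_around (G := G) (u := u) (v := v) h i
        obtain ⟨rfl, rfl⟩ | ⟨rfl, rfl⟩ := he.eq_and_eq_or_eq_and_eq hl
        · exact huv.symm _ _
        · exact huv
      · exact joined_necklace (hl.joined hf)
    · exact joined_necklace (h i hi _ _)
  exact fun p q => .trans _ _ _ ((base p).symm _ _) (base q)

open Classical in
/-- A spanning tree of the necklace is a spanning tree in all beads but one, and in that bead a
two-component forest separating its key vertices. -/
lemma isTreeSet_necklace_iff [∀ i, Finite (α i)] [∀ i, Finite (β i)] (huv : ∀ i, u i ≠ v i)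
    {e : ∀ i, β i} (he : ∀ i, (G i).IsLink (e i) (u i) (v i)) (F : Set (Σ i, β i)) :
    (necklace G u v).IsTreeSet F ↔ ∃ i₀, ∀ i,
      if i = i₀ then (G i).IsSplitSet (e i) (bead F i) else (G i).IsTreeSet (bead F i) := by
  have (i : Fin n) : Nonempty (α i) := ⟨u i⟩
  have hcard := card_vertex (u := u) (v := v) huv
  have hncard := ncard_eq_sum_bead F
  -- The bead `i₀` is padded by one, so that equality must hold in the bound for each bead.
  have hsum : ∀ i₀ : Fin n, ∑ i, ((bead F i).ncard + 1 + if i = i₀ then 1 else 0) =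
      F.ncard + 1 + n := by
    intro i₀
    simp only [Finset.sum_add_distrib, ← hncard]
    simp
    omega
  constructor
  · rintro ⟨hE, hF, hn⟩
    have hins := fun i => connects_insert_bead hF i (he i)
    have hconn : ∀ i, (G i).Joined (bead F i) (u i) (v i) → (G i).Connects (bead F i) := by
      intro i hi p q
      refine (hins i p q).mono_rel (joined_equivalence _ _) ?_
      rintro f (rfl | hf) a b hl
      · obtain ⟨rfl, rfl⟩ | ⟨rfl, rfl⟩ := (he i).eq_and_eq_or_eq_and_eq hl
        · exact hi
        · exact hi.symm _ _
      · exact hl.joined hf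
    obtain ⟨i₀, hi₀⟩ : ∃ i₀, ¬ (G i₀).Joined (bead F i₀) (u i₀) (v i₀) := by
      by_contra! hall
      have := Finset.sum_le_sum fun i (_ : i ∈ Finset.univ) => (hconn i (hall i)).card_le
      rw [Finset.sum_add_distrib, ← hncard] at this
      simp at this
      omega
    have hother : ∀ i, i ≠ i₀ → (G i).Connects (bead F i) := by
      intro i hi
      apply hconn
      by_contra hi'
      rcases hi.lt_or_gt with h | h
      · exact not_connects_of_two_cuts h hi' hi₀ hF
      · exact not_connects_of_two_cuts h hi₀ hi' hF
    have hle : ∀ i ∈ Finset.univ, Nat.card (α i) ≤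
        (bead F i).ncard + 1 + if i = i₀ then 1 else 0 := by
      intro i _
      split_ifs with h
      · have h1 := (hins i).card_le
        have h2 := Set.ncard_insert_le (e i) (bead F i)
        omega
      · exact (hother i h).card_le
    have heq := (Finset.sum_eq_sum_iff_of_le hle).1 (by rw [hsum]; omega)
    refine ⟨i₀, fun i => ?_⟩
    have hEi : bead F i ⊆ E(G i) := fun f hf => mem_edgeSet_necklace.1 (hE hf)
    have := heq i (Finset.mem_univ i)
    split_ifs with h
    · exact ⟨hEi, hins i, by simp [h] at this ⊢; omega⟩
    · exact ⟨hEi, hother i h, by simp [h] at this ⊢; omega⟩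
  · rintro ⟨i₀, h⟩
    have hother : ∀ i, i ≠ i₀ → (G i).IsTreeSet (bead F i) := fun i hi => by
      simpa [hi] using h i
    have h₀ : (G i₀).IsSplitSet (e i₀) (bead F i₀) := by simpa using h i₀
    refine ⟨?_, connects_necklace (he i₀) (fun i hi => (hother i hi).2.1) h₀.2.1, ?_⟩
    · rintro ⟨i, f⟩ hf
      rw [mem_edgeSet_necklace]
      by_cases hi : i = i₀
      · subst hi
        exact h₀.1 hf
      · exact (hother i hi).1 hf
    · have heq : ∀ i ∈ Finset.univ, ((bead F i).ncard + 1 + if i = i₀ then 1 else 0) =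
          Nat.card (α i) := by
        intro i _
        by_cases hi : i = i₀
        · subst hi
          simpa using h₀.2.2
        · simpa [hi] using (hother i hi).2.2
      have := hsum i₀
      rw [Finset.sum_congr rfl heq] at this
      omega

open Classical in
/-- The spanning trees of the necklace through an edge `f` of its `k`-th bead, sorted by the bead
that they disconnect. -/
lemma numSpanningTreesThrough_necklace [∀ i, Finite (α i)] [∀ i, Finite (β i)]
    (hV : ∀ i, V(G i) = Set.univ) (huv : ∀ i, u i ≠ v i)
    {e : ∀ i, β i} (he : ∀ i, (G i).IsLink (e i) (u i) (v i)) (f : Σ i, β i) :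
    (necklace G u v).numSpanningTreesThrough f = ∑ i₀, ∏ i,
      {F | (if i = i₀ then (G i).IsSplitSet (e i) F else (G i).IsTreeSet F) ∧
        (i = f.1 → f ∈ Sigma.mk i '' F)}.ncard := by
  have (i : Fin n) : Nonempty (α i) := ⟨u i⟩
  have : Nonempty (Quot (Glue u v)) := ⟨Quot.mk _ ⟨0, u 0⟩⟩
  have : Finite (Quot (Glue u v)) := Quot.finite _
  rw [numSpanningTreesThrough_eq (vertexSet_necklace hV)]
  simp only [← Nat.card_coe_set_eq, ← Nat.card_pi]
  rw [← Nat.card_sigma]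
  symm
  refine Nat.card_eq_of_bijective (fun x => ⟨{g | g.2 ∈ (x.2 g.1).1}, ?_, ?_⟩) ⟨?_, ?_⟩
  · exact (isTreeSet_necklace_iff huv he _).2 ⟨x.1, fun i => (x.2 i).2.1⟩
  · obtain ⟨g, hg, hgf⟩ := (x.2 f.1).2.2 rfl
    exact Set.mem_of_eq_of_mem hgf.symm
      (show (⟨f.1, g⟩ : Σ i, β i) ∈ {g | g.2 ∈ (x.2 g.1).1} from hg)
  -- Injective, as the disconnected bead is determined by the tree.
  · rintro ⟨i₀, x⟩ ⟨i₁, y⟩ h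
    have hxy : ∀ i, (x i).1 = (y i).1 := by
      intro i
      have h1 := congrArg (fun F => bead F.1 i) h
      exact h1
    obtain rfl : i₀ = i₁ := by
      by_contra hne
      have h1 := (x i₀).2.1
      have h2 := (y i₀).2.1
      rw [if_pos rfl] at h1
      rw [if_neg hne, ← hxy] at h2
      exact h1.not_connects h2.2.1
    congr
    funext i
    exact Subtype.ext (hxy i)
  · rintro ⟨F, hF, hf⟩
    obtain ⟨i₀, h⟩ := (isTreeSet_necklace_iff huv he F).1 hF
    exact ⟨⟨i₀, fun i => ⟨bead F i, h i, by rintro rfl; exact ⟨f.2, hf, rfl⟩⟩⟩, rfl⟩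

end Necklace

/-! ### Rooted parent maps and the matrix-tree theorem -/

namespace RootedForest

open Graph

variable {V : Type*} {R : Finset V}

/-- A parent map `h`, defined off the set `R` of roots, is rooted if following it from any vertex
leads to `R`: the relation "is the parent of" is well-founded off `R`. -/
def IsRooted (h : {p // p ∉ R} → V) : Prop :=
  WellFounded fun a b : {p // p ∉ R} => h b = a

/-- The edges from the vertices off `R` to their parents, together with the edges in `F₀`. -/
def treeOf (F₀ : Set (Sym2 V)) (h : {p // p ∉ R} → V) : Set (Sym2 V) :=
  F₀ ∪ Set.range fun p : {p // p ∉ R} => s(p.1, h p)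

lemma IsRooted.ne {h : {p // p ∉ R} → V} (hh : IsRooted h) {p q : {p // p ∉ R}}
    (hpq : h p = q) : h q ≠ p := fun hqp =>
  hh.asymmetric q p hpq hqp

/-- Two vertices with the same parent edge would be each other's parents. -/
lemma IsRooted.injective {h : {p // p ∉ R} → V} (hh : IsRooted h) :
    Function.Injective fun p : {p // p ∉ R} => s(p.1, h p) := by
  intro p q hpq
  rcases Sym2.eq_iff.1 hpq with ⟨h1, -⟩ | ⟨h1, h2⟩
  · exact Subtype.ext h1
  · exact absurd h1.symm (hh.ne h2)

lemma mem_treeOf {F₀ : Set (Sym2 V)} (hF₀ : ∀ e ∈ F₀, ∀ x ∈ e, x ∈ R) {h : {p // p ∉ R} → V}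
    (p : {p // p ∉ R}) (q : V) :
    s(p.1, q) ∈ treeOf F₀ h ↔ h p = q ∨ ∃ hq : q ∉ R, h ⟨q, hq⟩ = p := by
  constructor
  · rintro (he | ⟨a, ha⟩)
    · exact absurd (hF₀ _ he p.1 (Sym2.mem_mk_left _ _)) p.2
    · rcases Sym2.eq_iff.1 ha with ⟨h1, h2⟩ | ⟨h1, h2⟩
      · exact Or.inl (Subtype.ext h1 ▸ h2)
      · subst h1
        exact Or.inr ⟨a.2, h2⟩
  · rintro (rfl | ⟨hq, h2⟩)
    · exact Or.inr ⟨p, rfl⟩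
    · exact Or.inr ⟨⟨q, hq⟩, by simp [h2, Sym2.eq_swap]⟩

/-- Let `F₀` be the edge set of a tree on the vertices in `R`. The spanning trees containing `F₀`
correspond to the rooted parent maps along the edges of the graph: each vertex off `R` has as
parent its neighbour in the direction of `R`. -/
lemma bijOn_treeOf [Finite V] (S : SimpleGraph V) {F₀ : Set (Sym2 V)} {u : V} (hu : u ∈ R)
    (hFS : F₀ ⊆ S.edgeSet) (hF₀ : ∀ e ∈ F₀, ∀ x ∈ e, x ∈ R)
    (hcard : F₀.ncard + 1 = R.card) (hjoin : ∀ x ∈ R, (ofSimpleGraph S).Joined F₀ u x) :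
    Set.BijOn (treeOf F₀) {h : {p // p ∉ R} → V |
        IsRooted h ∧ ∀ p : {p // p ∉ R}, S.Adj p (h p)}
      {F | (ofSimpleGraph S).IsTreeSet F ∧ F₀ ⊆ F} := by
  classical
  have := Fintype.ofFinite V
  have hncard : ∀ h : {p // p ∉ R} → V, IsRooted h →
      (treeOf F₀ h).ncard + 1 = Nat.card V := by
    intro h hh
    rw [treeOf, Set.ncard_union_eq]
    · rw [← Set.image_univ, Set.ncard_image_of_injective _ hh.injective, Set.ncard_univ,
        Nat.card_eq_fintype_card, Nat.card_eq_fintype_card, Fintype.card_subtype_compl,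
        Fintype.card_coe]
      have := R.card_le_univ
      omega
    · rw [Set.disjoint_left]
      rintro _ he ⟨p, rfl⟩
      exact p.2 (hF₀ _ he p.1 (Sym2.mem_mk_left _ _))
  refine ⟨?_, ?_, ?_⟩
  · rintro h ⟨hh, hadj⟩
    refine ⟨⟨?_, ?_, hncard h hh⟩, Set.subset_union_left⟩
    · rintro e (he | ⟨p, rfl⟩)
      · exact hFS he
      · exact hadj p
    · have hR : ∀ x ∈ R, (ofSimpleGraph S).Joined (treeOf F₀ h) u x := fun x hx =>
        (hjoin x hx).mono_rel (joined_equivalence _ _) fun e he _ _ hl =>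
          hl.joined (Or.inl he)
      have hN : ∀ p : {p // p ∉ R}, (ofSimpleGraph S).Joined (treeOf F₀ h) u p := by
        intro p
        induction p using hh.induction with
        | _ p ih =>
          have hstep : (ofSimpleGraph S).Joined (treeOf F₀ h) (h p) p :=
            IsLink.joined (e := s(p.1, h p)) ⟨Sym2.eq_swap, hadj p⟩ (Or.inr ⟨p, rfl⟩)
          by_cases hp : h p ∈ R
          · exact .trans _ _ _ (hR _ hp) hstep
          · exact .trans _ _ _ (ih ⟨h p, hp⟩ rfl) hstep
      have hall : ∀ p, (ofSimpleGraph S).Joined (treeOf F₀ h) u p := fun p =>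
        if hp : p ∈ R then hR p hp else hN ⟨p, hp⟩
      exact fun p q => .trans _ _ _ ((hall p).symm _ _) (hall q)
  · rintro h ⟨hh, -⟩ h' ⟨hh', -⟩ heq
    funext p
    induction p using hh.induction with
    | _ p ih =>
      have hp : s(p.1, h p) ∈ treeOf F₀ h' := heq ▸ Or.inr ⟨p, rfl⟩
      rcases (mem_treeOf hF₀ p _).1 hp with h1 | ⟨hq, h1⟩
      · exact h1.symm
      · rw [← ih ⟨h p, hq⟩ rfl] at h1
        exact absurd h1 (hh.ne rfl)
  · rintro T ⟨⟨hTS, hT, hTn⟩, hFT⟩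
    have : Nonempty V := ⟨u⟩
    have hconn := linkGraph_connected_iff.2 hT
    set H := (ofSimpleGraph S).linkGraph T with hH
    have hparent : ∀ p : {p // p ∉ R}, ∃ q, s(p.1, q) ∈ T ∧ H.dist q u < H.dist p u := by
      intro p
      obtain ⟨w, hw⟩ := hconn.exists_walk_length_eq_dist p.1 u
      revert hw
      cases w with
      | nil => exact fun _ => absurd hu p.2
      | @cons _ q _ hadj w =>
        intro hw
        obtain ⟨e, he, hl⟩ := hadj.2
        refine ⟨q, hl.1 ▸ he, ?_⟩
        rw [← hw, SimpleGraph.Walk.length_cons]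
        exact Nat.lt_succ_of_le (SimpleGraph.dist_le w)
    -- The parent of a vertex is a neighbour in `T` that is closer to `u`.
    choose h hmem hdist using hparent
    have hh : IsRooted h := by
      refine Subrelation.wf ?_ (measure fun p : {p // p ∉ R} => H.dist p u).wf
      intro a b hab
      have := hdist b
      rw [hab] at this
      exact this
    refine ⟨h, ⟨hh, fun p => hTS (hmem p)⟩, ?_⟩
    refine Set.eq_of_subset_of_ncard_le ?_ (by have := hncard h hh; omega)
    rintro e (he | ⟨p, rfl⟩)
    · exact hFT he
    · exact hmem p

section MatrixTree

variable [DecidableEq V]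

/-- The Laplacian of a parent map: the identity minus the incidence of each vertex to its
parent. -/
def parentMatrix (h : {p // p ∉ R} → V) : Matrix {p // p ∉ R} {p // p ∉ R} ℚ :=
  Matrix.of fun p q => (if p = q then 1 else 0) - if (q : V) = h p then 1 else 0

/-- If the parent map is rooted, then `parentMatrix` is triangular with unit diagonal for an order
in which parents come first. -/
lemma det_parentMatrix_of_isRooted [Fintype V] {h : {p // p ∉ R} → V} (hh : IsRooted h) :
    (parentMatrix h).det = 1 := by
  have : IsWellFounded _ (fun a b : {p // p ∉ R} => h b = a) := ⟨hh⟩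
  let b : {p // p ∉ R} → Ordinalᵒᵈ := fun p =>
    OrderDual.toDual (IsWellFounded.rank (fun a b : {p // p ∉ R} => h b = a) p)
  have hb : ∀ p q : {p // p ∉ R}, h p = q → b p < b q := fun p q hpq =>
    OrderDual.toDual_lt_toDual.2 (IsWellFounded.rank_lt_of_rel (r := fun a b => h b = a.1) hpq)
  have htri : (parentMatrix h).BlockTriangular b := by
    intro p q hlt
    have h1 : p ≠ q := by rintro rfl; exact lt_irrefl _ hlt
    have h2 : (q : V) ≠ h p := fun heq => lt_asymm hlt (hb p q heq.symm)
    simp [parentMatrix, h1, h2]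
  rw [htri.det]
  refine Finset.prod_eq_one fun a _ => ?_
  have : (parentMatrix h).toSquareBlock b a = 1 := by
    ext ⟨p, hp⟩ ⟨q, hq⟩
    have h2 : (q : V) ≠ h p := fun heq => (hb p q heq.symm).ne (hp.trans hq.symm)
    simp [parentMatrix, Matrix.toSquareBlock_def, h2, Matrix.one_apply]
  rw [this, Matrix.det_one]

/-- If the parent map is not rooted, then the indicator function of the vertices that do not lead
to `R` is in the kernel of `parentMatrix`. -/
lemma det_parentMatrix_of_not_isRooted [Fintype V] {h : {p // p ∉ R} → V} (hh : ¬ IsRooted h) :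
    (parentMatrix h).det = 0 := by
  classical
  rw [← Matrix.exists_mulVec_eq_zero_iff]
  let r : {p // p ∉ R} → {p // p ∉ R} → Prop := fun a b => h b = a
  let x : {p // p ∉ R} → ℚ := fun p => if Acc r p then 0 else 1
  refine ⟨x, fun hx => hh ⟨fun p => ?_⟩, ?_⟩
  · by_contra hp
    have := congrFun hx p
    exact one_ne_zero ((if_neg hp).symm.trans this)
  · funext p
    -- A vertex leads to `R` exactly when its parent does.
    have hsum : ∑ q : {p // p ∉ R}, (if (q : V) = h p then x q else 0) = x p := by
      by_cases hp : h p ∈ R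
      · have hacc : Acc r p := ⟨_, fun q hq => absurd (show h p = q from hq) fun heq =>
          q.2 (heq ▸ hp)⟩
        rw [Finset.sum_eq_zero]
        · simp [x, hacc]
        · intro q _
          rw [if_neg]
          exact fun heq => q.2 (heq ▸ hp)
      · rw [Finset.sum_eq_single ⟨h p, hp⟩]
        · have : Acc r ⟨h p, hp⟩ ↔ Acc r p :=
            ⟨fun hacc => ⟨_, fun q hq => by
              have : q = ⟨h p, hp⟩ := Subtype.ext (show h p = q from hq).symm
              rwa [this]⟩, fun hacc => hacc.inv rfl⟩
          simp [x, this]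
        · intro q _ hq
          rw [if_neg]
          exact fun heq => hq (Subtype.ext heq)
        · simp
    simp only [Matrix.mulVec, dotProduct, parentMatrix, Matrix.of_apply, sub_mul, ite_mul, one_mul,
      zero_mul, Finset.sum_sub_distrib, hsum]
    simp

/-- The directed matrix-tree theorem. Expanding the Laplacian along its rows yields a signed sum
over all parent maps, in which exactly the rooted ones contribute. -/
theorem sum_isRooted_eq_det [Fintype V] (w : {p // p ∉ R} → V → ℚ)
    [DecidablePred (IsRooted (R := R))] :
    ∑ h : {p // p ∉ R} → V, (if IsRooted h then ∏ p, w p (h p) else 0) =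
      (Matrix.of fun p q : {p // p ∉ R} => (if p = q then ∑ x, w p x else 0) - w p q).det := by
  have hrow : (Matrix.of fun p q : {p // p ∉ R} => (if p = q then ∑ x, w p x else 0) - w p q) =
      fun p => ∑ x, w p x • fun q : {p // p ∉ R} =>
        ((if p = q then 1 else 0) - if (q : V) = x then 1 else 0 : ℚ) := by
    funext p q
    simp only [Matrix.of_apply, Finset.sum_apply, Pi.smul_apply, smul_eq_mul, mul_sub,
      Finset.sum_sub_distrib, mul_ite, mul_one, mul_zero, Finset.sum_ite_eq, Finset.mem_univ,
      if_true]
    split_ifs <;> simp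
  rw [hrow]
  change _ = Matrix.detRowAlternating.toMultilinearMap _
  rw [MultilinearMap.map_sum]
  refine Finset.sum_congr rfl fun h _ => ?_
  rw [MultilinearMap.map_smul_univ]
  change _ = _ • (parentMatrix h).det
  split_ifs with hh
  · rw [det_parentMatrix_of_isRooted hh, smul_eq_mul, mul_one]
  · rw [det_parentMatrix_of_not_isRooted hh, smul_zero]

theorem ncard_isRooted_eq_det [Fintype V] (A : {p // p ∉ R} → V → Prop)
    [∀ p, DecidablePred (A p)] :
    ({h : {p // p ∉ R} → V | IsRooted h ∧ ∀ p, A p (h p)}.ncard : ℚ) =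
      (Matrix.of fun p q : {p // p ∉ R} =>
        (if p = q then ((Finset.univ.filter (A p)).card : ℚ) else 0) -
          if A p q then 1 else 0).det := by
  classical
  have h1 := sum_isRooted_eq_det (R := R) fun p x => if A p x then 1 else 0
  simp only [Finset.sum_boole] at h1
  rw [← h1, Set.ncard_eq_toFinset_card', Set.toFinset_ofFinset, Finset.card_filter]
  push_cast
  refine Finset.sum_congr rfl fun h _ => ?_
  rw [Finset.prod_boole]
  simp [ite_and]

end MatrixTree

end RootedForest

/-! ### Rooted forests in complete bipartite graphs -/

namespace RootedForest

open Graph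

section Bipartite

/-- A block determinant whose off-diagonal block of constant rows makes the Schur complement a
rank-one perturbation of a scalar matrix. -/
lemma det_fromBlocks_const {P Q : Type*} [Fintype P] [Fintype Q] [DecidableEq P] [DecidableEq Q]
    (l : ℚ) (hl : l ≠ 0) (d : Q → ℚ) (hd : ∀ y, d y ≠ 0) (C : Matrix Q P ℚ) :
    (Matrix.fromBlocks (Matrix.diagonal fun _ => l) (Matrix.of fun _ _ => -1) (-C)
      (Matrix.diagonal d)).det =
    (∏ y, d y) * l ^ Fintype.card P * (1 - (∑ y, (∑ x, C y x) / d y) / l) := by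
  have : Invertible d := ⟨fun y => (d y)⁻¹, by ext y; simp [hd], by ext y; simp [hd]⟩
  have : Invertible (Matrix.diagonal d) := Matrix.diagonalInvertible d
  rw [Matrix.det_fromBlocks₂₂, Matrix.det_diagonal, mul_assoc]
  congr 1
  have hschur : (Matrix.diagonal fun _ : P => l) -
      (Matrix.of fun _ _ => -1 : Matrix P Q ℚ) * ⅟(Matrix.diagonal d) * -C =
      l • (1 + Matrix.replicateCol Unit (fun _ : P => (1 : ℚ)) *
        Matrix.replicateRow Unit fun x => -(∑ y, C y x / d y) / l) := by
    rw [Matrix.invOf_diagonal_eq]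
    ext i j
    have hinv : ⅟d = fun y => (d y)⁻¹ := invOf_eq_right_inv (by ext y; simp [hd])
    simp only [Matrix.sub_apply, Matrix.mul_apply, Matrix.smul_apply,
      Matrix.add_apply, hinv]
    simp only [Matrix.diagonal_apply, Matrix.one_apply, Matrix.of_apply, Matrix.neg_apply,
      Matrix.replicateCol_apply, Matrix.replicateRow_apply, smul_eq_mul, Finset.univ_unique,
      Finset.sum_singleton, mul_add, one_mul]
    rw [mul_div_cancel₀ _ hl, sub_eq_add_neg]
    congr 1
    · simp
    · rw [neg_inj]
      refine Finset.sum_congr rfl fun y _ => ?_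
      simp only [neg_mul, one_mul, Finset.sum_neg_distrib, Finset.sum_ite_eq', Finset.mem_univ,
        if_true]
      ring
  rw [hschur, Matrix.det_smul, Matrix.det_one_add_replicateCol_mul_replicateRow]
  congr 1
  simp only [dotProduct, mul_one, sub_eq_add_neg]
  congr 1
  simp only [Finset.sum_div, Finset.sum_neg_distrib, neg_div]
  rw [Finset.sum_comm]

lemma card_filter_iff_not {V : Type*} [Fintype V] (a : V → Prop) [DecidablePred a] {p : V} (hp : ¬ a p) :
    (Finset.univ.filter fun q => (a p ↔ ¬ a q)).card = Fintype.card {q // a q} := by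
  rw [Fintype.card_subtype]
  congr 1
  ext q
  simp [hp]

variable {V : Type*} [Fintype V] [DecidableEq V] {R : Finset V}

/-- Counting rooted parent maps along a bipartite relation `A` with classes `a` and `¬ a`, in which
the vertices of class `a` may choose any parent in the other class. -/
lemma ncard_isRooted_bipartite (a : V → Prop) [DecidablePred a]
    (A : {p // p ∉ R} → V → Prop) [∀ p, DecidablePred (A p)]
    (hA : ∀ p q, A p q → (a p ↔ ¬ a q)) (hfree : ∀ p q, a p.1 → ¬ a q → A p q)
    (hl : Fintype.card {q // ¬ a q} ≠ 0)
    (hd : ∀ p, ¬ a p.1 → (Finset.univ.filter (A p)).card ≠ 0) :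
    ({h : {p // p ∉ R} → V | IsRooted h ∧ ∀ p, A p (h p)}.ncard : ℚ) =
      (∏ p : {p : {p // p ∉ R} // ¬ a p.1}, ((Finset.univ.filter (A p.1)).card : ℚ)) *
      (Fintype.card {q // ¬ a q} : ℚ) ^ Fintype.card {p : {p // p ∉ R} // a p.1} *
      (1 - (∑ p : {p : {p // p ∉ R} // ¬ a p.1},
        (∑ q : {p : {p // p ∉ R} // a p.1}, if A p.1 q.1 then (1 : ℚ) else 0) /
          ((Finset.univ.filter (A p.1)).card : ℚ)) / (Fintype.card {q // ¬ a q} : ℚ)) := by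
  have h := det_fromBlocks_const (P := {p : {p // p ∉ R} // a p.1})
    (Q := {p : {p // p ∉ R} // ¬ a p.1})
    (Fintype.card {q // ¬ a q} : ℚ) (by exact_mod_cast hl)
    (fun p => ((Finset.univ.filter (A p.1)).card : ℚ)) (fun p => by exact_mod_cast hd p.1 p.2)
    (Matrix.of fun p q => if A p.1 q.1 then 1 else 0)
  simp only [Matrix.of_apply] at h
  rw [← h, ncard_isRooted_eq_det,
    ← Matrix.det_submatrix_equiv_self (Equiv.sumCompl fun p : {p // p ∉ R} => a p.1)]
  congr 1
  ext (p | p) (q | q)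
  · have h1 : ¬ A p.1 q.1 := fun h => (hA _ _ h).1 p.2 q.2
    have h2 : (Finset.univ.filter (A p.1)).card = Fintype.card {q // ¬ a q} := by
      rw [Fintype.card_subtype]
      congr 1
      ext q
      simp only [Finset.mem_filter, Finset.mem_univ, true_and]
      exact ⟨fun h => (hA _ _ h).1 p.2, fun h => hfree _ _ p.2 h⟩
    simp [Matrix.diagonal_apply, h1, h2, Subtype.val_inj]
  · have h1 : p.1 ≠ q.1 := fun h => q.2 (h ▸ p.2)
    have h2 : A p.1 q.1 := hfree _ _ p.2 q.2
    simp [h1, h2]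
  · have h1 : p.1 ≠ q.1 := fun h => p.2 (h ▸ q.2)
    simp [h1]
  · have h1 : ¬ A p.1 q.1 := fun h => p.2 ((hA _ _ h).2 q.2)
    simp [Matrix.diagonal_apply, h1, Subtype.val_inj]

/-- The number of spanning forests of a complete bipartite graph rooted at `R`. -/
lemma ncard_isRooted_complete (a : V → Prop) [DecidablePred a]
    (hm : Fintype.card {q // a q} ≠ 0) (hl : Fintype.card {q // ¬ a q} ≠ 0) :
    ({h : {p // p ∉ R} → V | IsRooted h ∧ ∀ p : {p // p ∉ R}, (a p ↔ ¬ a (h p))}.ncard : ℚ) =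
      (Fintype.card {q // a q} : ℚ) ^ Fintype.card {p : {p // p ∉ R} // ¬ a p.1} *
      (Fintype.card {q // ¬ a q} : ℚ) ^ Fintype.card {p : {p // p ∉ R} // a p.1} *
      (1 - Fintype.card {p : {p // p ∉ R} // ¬ a p.1} *
        Fintype.card {p : {p // p ∉ R} // a p.1} /
          (Fintype.card {q // a q} * Fintype.card {q // ¬ a q} : ℚ)) := by
  rw [ncard_isRooted_bipartite a (fun p q => (a p ↔ ¬ a q)) (fun _ _ h => h)
    (fun p q hp hq => by simp [hp, hq]) hl (fun p hp => by rwa [card_filter_iff_not a hp])]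
  have h1 : ∀ p : {p : {p // p ∉ R} // ¬ a p.1},
      ((Finset.univ.filter fun q => (a p.1 ↔ ¬ a q)).card : ℚ) = Fintype.card {q // a q} :=
    fun p => by rw [card_filter_iff_not a p.2]
  have h2 : ∀ p : {p : {p // p ∉ R} // ¬ a p.1},
      (∑ q : {p : {p // p ∉ R} // a p.1}, if (a p.1 ↔ ¬ a q.1) then (1 : ℚ) else 0) =
        Fintype.card {p : {p // p ∉ R} // a p.1} := by
    intro p
    simp [p.2, fun q : {p : {p // p ∉ R} // a p.1} => q.2]
  simp only [h1, h2, Finset.prod_const, Finset.sum_const, Finset.card_univ, nsmul_eq_mul]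
  congr 2
  rw [← mul_div_assoc, div_div]

/-- The number of spanning forests of a complete bipartite graph rooted at `R`, in which the
vertex `z` has the parent `t`. -/
lemma ncard_isRooted_complete_parent (a : V → Prop) [DecidablePred a] {z t : V} (hz : z ∉ R)
    (ht : t ∉ R) (haz : ¬ a z) (hat : a t) :
    ({h : {p // p ∉ R} → V | IsRooted h ∧
        ∀ p : {p // p ∉ R}, (a p ↔ ¬ a (h p)) ∧ (p.1 = z → h p = t)}.ncard : ℚ) =
      (Fintype.card {q // a q} : ℚ) ^ (Fintype.card {p : {p // p ∉ R} // ¬ a p.1} - 1) *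
      (Fintype.card {q // ¬ a q} : ℚ) ^ Fintype.card {p : {p // p ∉ R} // a p.1} *
      (1 - ((Fintype.card {p : {p // p ∉ R} // ¬ a p.1} - 1) *
        Fintype.card {p : {p // p ∉ R} // a p.1} / Fintype.card {q // a q} + 1) /
          (Fintype.card {q // ¬ a q} : ℚ)) := by
  have hm : Fintype.card {q // a q} ≠ 0 := (Fintype.card_pos_iff.2 ⟨⟨t, hat⟩⟩).ne'
  have hl : Fintype.card {q // ¬ a q} ≠ 0 := (Fintype.card_pos_iff.2 ⟨⟨z, haz⟩⟩).ne'
  -- The row of `z` has a single possible parent, and all other rows are free.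
  have hdz : (Finset.univ.filter fun q => (a z ↔ ¬ a q) ∧ (z = z → q = t)).card = 1 := by
    rw [Finset.card_eq_one]
    refine ⟨t, ?_⟩
    ext q
    simp only [Finset.mem_filter, Finset.mem_univ, true_and, Finset.mem_singleton, forall_const]
    exact ⟨fun h => h.2, by rintro rfl; simp [haz, hat]⟩
  have hd : ∀ p, ¬ a p → p ≠ z → (Finset.univ.filter fun q =>
      (a p ↔ ¬ a q) ∧ (p = z → q = t)).card = Fintype.card {q // a q} := by
    intro p hp hpz
    rw [← card_filter_iff_not a hp]
    simp [hpz]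
  rw [ncard_isRooted_bipartite a (fun p q => (a p ↔ ¬ a q) ∧ (p.1 = z → q = t))
    (fun _ _ h => h.1) (fun p q hp hq => ⟨by simp [hp, hq], by rintro rfl; exact absurd hp haz⟩)
    hl (fun p hp => ?_)]
  · let z' : {p : {p // p ∉ R} // ¬ a p.1} := ⟨⟨z, hz⟩, haz⟩
    have hz' : ∀ p : {p : {p // p ∉ R} // ¬ a p.1}, p ≠ z' → p.1.1 ≠ z := fun p hp h =>
      hp (Subtype.ext (Subtype.ext h))
    have h1 : ∀ p ∈ Finset.univ.erase z',
        ((Finset.univ.filter fun q => (a p.1 ↔ ¬ a q) ∧ (p.1.1 = z → q = t)).card : ℚ) =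
          Fintype.card {q // a q} :=
      fun p hp => by rw [hd p.1.1 p.2 (hz' p (Finset.ne_of_mem_erase hp))]
    have h2 : ∀ p ∈ Finset.univ.erase z',
        (∑ q : {p : {p // p ∉ R} // a p.1},
          if (a p.1 ↔ ¬ a q.1) ∧ (p.1.1 = z → q.1.1 = t) then (1 : ℚ) else 0) /
          ((Finset.univ.filter fun q => (a p.1 ↔ ¬ a q) ∧ (p.1.1 = z → q = t)).card : ℚ) =
        Fintype.card {p : {p // p ∉ R} // a p.1} / Fintype.card {q // a q} := by
      intro p hp
      rw [h1 p hp]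
      simp [p.2, hz' p (Finset.ne_of_mem_erase hp), fun q : {p : {p // p ∉ R} // a p.1} => q.2]
    have h3 : (∑ q : {p : {p // p ∉ R} // a p.1},
        if (a z'.1 ↔ ¬ a q.1) ∧ (z'.1.1 = z → q.1.1 = t) then (1 : ℚ) else 0) = 1 := by
      rw [Finset.sum_eq_single ⟨⟨t, ht⟩, hat⟩]
      · simp [z', haz, hat]
      · rintro q - hq
        rw [if_neg]
        rintro ⟨-, h⟩
        exact hq (Subtype.ext (Subtype.ext (h rfl)))
      · simp
    have hcard : ((Finset.univ.erase z').card : ℚ) =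
        Fintype.card {p : {p // p ∉ R} // ¬ a p.1} - 1 := by
      rw [Finset.card_erase_of_mem (Finset.mem_univ _), Finset.card_univ,
        Nat.cast_sub (Fintype.card_pos_iff.2 ⟨z'⟩), Nat.cast_one]
    rw [← Finset.mul_prod_erase _ _ (Finset.mem_univ z'),
      ← Finset.add_sum_erase _ _ (Finset.mem_univ z'), Finset.prod_congr rfl h1,
      Finset.sum_congr rfl h2, h3]
    have hdz' : (Finset.univ.filter fun q =>
      (a z'.1 ↔ ¬ a q) ∧ (z'.1.1 = z → q = t)).card = 1 := hdz
    rw [hdz', Finset.prod_const, Finset.sum_const, nsmul_eq_mul, hcard,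
      Finset.card_erase_of_mem (Finset.mem_univ _), Finset.card_univ]
    push_cast
    ring
  · by_cases hpz : p.1 = z
    · obtain ⟨p, hpR⟩ := p
      obtain rfl : p = z := hpz
      exact hdz.trans_ne one_ne_zero
    · rwa [hd p.1 hp hpz]

end Bipartite

end RootedForest

/-! ### Spanning trees of complete bipartite beads -/

namespace Necklace

open Graph RootedForest

section CompleteBipartite

variable {r s : ℕ}

lemma card_inl (P : Fin r ⊕ Fin s → Prop) [DecidablePred P] (h1 : ∀ x, P (.inl x))
    (h2 : ∀ y, ¬ P (.inr y)) : Fintype.card {q // P q} = r := by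
  rw [Fintype.card_congr Equiv.subtypeSum, Fintype.card_sum]
  simp [h1, h2]

lemma card_inr (P : Fin r ⊕ Fin s → Prop) [DecidablePred P] (h1 : ∀ x, ¬ P (.inl x))
    (h2 : ∀ y, P (.inr y)) : Fintype.card {q // P q} = s := by
  rw [Fintype.card_congr Equiv.subtypeSum, Fintype.card_sum]
  simp [h1, h2]

lemma card_inl_notMem (A : Finset (Fin r)) (B : Finset (Fin s)) (P : Fin r ⊕ Fin s → Prop)
    [DecidablePred P] (h1 : ∀ x, P (.inl x)) (h2 : ∀ y, ¬ P (.inr y)) :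
    Fintype.card {p : {p // p ∉ A.disjSum B} // P p.1} = r - A.card := by
  rw [Fintype.card_congr (Equiv.subtypeSubtypeEquivSubtypeInter _ P),
    Fintype.card_congr Equiv.subtypeSum, Fintype.card_sum]
  simp [h1, h2, Fintype.card_subtype_compl]

lemma card_inr_notMem (A : Finset (Fin r)) (B : Finset (Fin s)) (P : Fin r ⊕ Fin s → Prop)
    [DecidablePred P] (h1 : ∀ x, ¬ P (.inl x)) (h2 : ∀ y, P (.inr y)) :
    Fintype.card {p : {p // p ∉ A.disjSum B} // P p.1} = s - B.card := by
  rw [Fintype.card_congr (Equiv.subtypeSubtypeEquivSubtypeInter _ P),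
    Fintype.card_congr Equiv.subtypeSum, Fintype.card_sum]
  simp [h1, h2, Fintype.card_subtype_compl]

lemma adj_iff_isLeft (p q : Fin r ⊕ Fin s) :
    (completeBipartiteGraph (Fin r) (Fin s)).Adj p q ↔ (p.isLeft ↔ ¬ q.isLeft) := by
  cases p <;> cases q <;> simp [completeBipartiteGraph]

lemma adj_iff_isRight (p q : Fin r ⊕ Fin s) :
    (completeBipartiteGraph (Fin r) (Fin s)).Adj p q ↔ (p.isRight ↔ ¬ q.isRight) := by
  cases p <;> cases q <;> simp [completeBipartiteGraph]

/-- The number of spanning forests of `K r s` rooted at `A ∪ B`. -/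
lemma ncard_isRooted_K (hr : r ≠ 0) (hs : s ≠ 0) (A : Finset (Fin r)) (B : Finset (Fin s)) :
    ({h : {p // p ∉ A.disjSum B} → Fin r ⊕ Fin s | IsRooted h ∧
        ∀ p : {p // p ∉ A.disjSum B},
          (completeBipartiteGraph (Fin r) (Fin s)).Adj p (h p)}.ncard : ℚ) =
      (r : ℚ) ^ (s - B.card) * (s : ℚ) ^ (r - A.card) *
        (1 - ((s - B.card : ℕ) : ℚ) * ((r - A.card : ℕ) : ℚ) / (r * s)) := by
  have h1 := card_inl (r := r) (s := s) (fun p => p.isLeft = true) (by simp) (by simp)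
  have h2 := card_inr (r := r) (s := s) (fun p => ¬ p.isLeft = true) (by simp) (by simp)
  have h3 := card_inl_notMem A B (fun p => p.isLeft = true) (by simp) (by simp)
  have h4 := card_inr_notMem A B (fun p => ¬ p.isLeft = true) (by simp) (by simp)
  simp only [adj_iff_isLeft]
  rw [ncard_isRooted_complete (fun p : Fin r ⊕ Fin s => p.isLeft = true) (by rwa [h1])
    (by rwa [h2]), h1, h2, h3, h4]

/-- The number of spanning forests of `K r s` rooted at `A ∪ B` in which `x` is the parent of `y`. -/
lemma ncard_isRooted_K_parent_inr {A : Finset (Fin r)} {B : Finset (Fin s)} {x : Fin r}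
    {y : Fin s} (hx : x ∉ A) (hy : y ∉ B) :
    ({h : {p // p ∉ A.disjSum B} → Fin r ⊕ Fin s | IsRooted h ∧
        ∀ p : {p // p ∉ A.disjSum B}, (completeBipartiteGraph (Fin r) (Fin s)).Adj p (h p) ∧
          (p.1 = .inr y → h p = .inl x)}.ncard : ℚ) =
      (r : ℚ) ^ (s - B.card - 1) * (s : ℚ) ^ (r - A.card) *
        (1 - (((s - B.card : ℕ) - 1 : ℚ) * ((r - A.card : ℕ) : ℚ) / r + 1) / s) := by
  have h1 := card_inl (r := r) (s := s) (fun p => p.isLeft = true) (by simp) (by simp)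
  have h2 := card_inr (r := r) (s := s) (fun p => ¬ p.isLeft = true) (by simp) (by simp)
  have h3 := card_inl_notMem A B (fun p => p.isLeft = true) (by simp) (by simp)
  have h4 := card_inr_notMem A B (fun p => ¬ p.isLeft = true) (by simp) (by simp)
  simp only [adj_iff_isLeft]
  rw [ncard_isRooted_complete_parent (fun p : Fin r ⊕ Fin s => p.isLeft = true) (by simpa)
    (by simpa) (by simp) (by simp), h1, h2, h3, h4]

/-- The number of spanning forests of `K r s` rooted at `A ∪ B` in which `y` is the parent of `x`. -/
lemma ncard_isRooted_K_parent_inl {A : Finset (Fin r)} {B : Finset (Fin s)} {x : Fin r}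
    {y : Fin s} (hx : x ∉ A) (hy : y ∉ B) :
    ({h : {p // p ∉ A.disjSum B} → Fin r ⊕ Fin s | IsRooted h ∧
        ∀ p : {p // p ∉ A.disjSum B}, (completeBipartiteGraph (Fin r) (Fin s)).Adj p (h p) ∧
          (p.1 = .inl x → h p = .inr y)}.ncard : ℚ) =
      (s : ℚ) ^ (r - A.card - 1) * (r : ℚ) ^ (s - B.card) *
        (1 - (((r - A.card : ℕ) - 1 : ℚ) * ((s - B.card : ℕ) : ℚ) / s + 1) / r) := by
  have h1 := card_inr (r := r) (s := s) (fun p => p.isRight = true) (by simp) (by simp)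
  have h2 := card_inl (r := r) (s := s) (fun p => ¬ p.isRight = true) (by simp) (by simp)
  have h3 := card_inr_notMem A B (fun p => p.isRight = true) (by simp) (by simp)
  have h4 := card_inl_notMem A B (fun p => ¬ p.isRight = true) (by simp) (by simp)
  simp only [adj_iff_isRight]
  rw [ncard_isRooted_complete_parent (fun p : Fin r ⊕ Fin s => p.isRight = true) (by simpa)
    (by simpa) (by simp) (by simp), h1, h2, h3, h4]

/-- The number of spanning trees of `K r s` containing a given tree `F₀` with vertices `A ∪ B`. -/
lemma ncard_isTreeSet_K_superset (A : Finset (Fin r)) (B : Finset (Fin s)) (hs : s ≠ 0)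
    {F₀ : Set (Sym2 (Fin r ⊕ Fin s))} {a : Fin r} (ha : a ∈ A)
    (hFS : F₀ ⊆ E(K r s)) (hF₀ : ∀ e ∈ F₀, ∀ x ∈ e, x ∈ A.disjSum B)
    (hcard : F₀.ncard + 1 = A.card + B.card)
    (hjoin : ∀ x ∈ A.disjSum B, (K r s).Joined F₀ (.inl a) x) :
    ({F | (K r s).IsTreeSet F ∧ F₀ ⊆ F}.ncard : ℚ) =
      (r : ℚ) ^ (s - B.card) * (s : ℚ) ^ (r - A.card) *
        (1 - ((s - B.card : ℕ) : ℚ) * ((r - A.card : ℕ) : ℚ) / (r * s)) := by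
  have hbij := bijOn_treeOf (completeBipartiteGraph (Fin r) (Fin s)) (F₀ := F₀)
    (R := A.disjSum B) (u := .inl a) (by simpa) hFS hF₀ (by rwa [Finset.card_disjSum]) hjoin
  rw [← ncard_isRooted_K a.pos.ne' hs A B, ← hbij.image_eq,
    hbij.injOn.ncard_image]

lemma mem_edgeSet_K (x : Fin r) (y : Fin s) : s(Sum.inl x, Sum.inr y) ∈ E(K r s) := by
  simp [K]

lemma isLink_K (x : Fin r) (y : Fin s) :
    (K r s).IsLink s(.inl x, .inr y) (.inl x) (.inr y) :=
  ⟨rfl, mem_edgeSet_K x y⟩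

/-- The number of spanning trees of `K r s`. -/
lemma ncard_isTreeSet_K (hr : r ≠ 0) (hs : s ≠ 0) :
    ({F | (K r s).IsTreeSet F}.ncard : ℚ) = (r : ℚ) ^ (s - 1) * (s : ℚ) ^ (r - 1) := by
  obtain ⟨r, rfl⟩ := Nat.exists_eq_succ_of_ne_zero hr
  obtain ⟨s, rfl⟩ := Nat.exists_eq_succ_of_ne_zero hs
  have h := ncard_isTreeSet_K_superset (r := r.succ) {0} ∅ hs (F₀ := ∅) (a := 0) (by simp)
    (by simp) (by simp) (by simp) (by
      intro x hx
      simp only [Finset.mem_disjSum, Finset.mem_singleton, Finset.notMem_empty, false_and,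
        exists_false, or_false] at hx
      obtain ⟨_, rfl, rfl⟩ := hx
      exact .refl _)
  simp only [Set.empty_subset, and_true] at h
  rw [h]
  simp only [Finset.card_empty, Finset.card_singleton, Nat.succ_eq_add_one, Nat.sub_zero,
    Nat.add_sub_cancel]
  push_cast
  field_simp
  ring

/-- The number of spanning trees of `K r s` through a given edge. -/
lemma ncard_isTreeSet_K_mem (a : Fin r) (b : Fin s) :
    ({F | (K r s).IsTreeSet F ∧ s(.inl a, .inr b) ∈ F}.ncard : ℚ) =
      (r : ℚ) ^ (s - 1) * (s : ℚ) ^ (r - 1) * (((r : ℚ) + s - 1) / (r * s)) := by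
  have h := ncard_isTreeSet_K_superset {a} {b} b.pos.ne' (F₀ := {s(.inl a, .inr b)}) (a := a)
    (by simp) (by simp) (by simp) (by simp) (by
      intro x hx
      simp only [Finset.mem_disjSum, Finset.mem_singleton] at hx
      obtain ⟨_, rfl, rfl⟩ | ⟨_, rfl, rfl⟩ := hx
      · exact .refl _
      · exact (isLink_K _ _).joined rfl)
  simp only [Set.singleton_subset_iff] at h
  rw [h]
  obtain ⟨r, rfl⟩ := Nat.exists_eq_succ_of_ne_zero a.pos.ne'
  obtain ⟨s, rfl⟩ := Nat.exists_eq_succ_of_ne_zero b.pos.ne'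
  simp only [Finset.card_singleton, Nat.succ_eq_add_one, Nat.add_sub_cancel]
  push_cast
  field_simp
  ring

/-- The number of spanning trees of `K r s` through two edges that meet in the first part. -/
lemma ncard_isTreeSet_K_mem_mem_left (a : Fin r) {b y : Fin s} (hby : b ≠ y) :
    ({F | (K r s).IsTreeSet F ∧ s(.inl a, .inr b) ∈ F ∧ s(.inl a, .inr y) ∈ F}.ncard : ℚ) =
      (r : ℚ) ^ (s - 1) * (s : ℚ) ^ (r - 1) *
        ((((r : ℚ) + s - 1) / (r * s)) ^ 2 - ((r : ℚ) - 1) ^ 2 / ((r : ℚ) ^ 2 * (s : ℚ) ^ 2)) := by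
  have hne : (s(.inl a, .inr b) : Sym2 (Fin r ⊕ Fin s)) ≠ s(.inl a, .inr y) := by
    simp [hby]
  have h := ncard_isTreeSet_K_superset {a} {b, y} b.pos.ne'
    (F₀ := {s(.inl a, .inr b), s(.inl a, .inr y)}) (a := a)
    (by simp) (by simp [Set.insert_subset_iff]) (by simp)
    (by rw [Set.ncard_pair hne, Finset.card_pair hby, Finset.card_singleton]) (by
      intro x hx
      simp only [Finset.mem_disjSum, Finset.mem_singleton, Finset.mem_insert] at hx
      obtain ⟨_, rfl, rfl⟩ | ⟨_, rfl | rfl, rfl⟩ := hx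
      · exact .refl _
      · exact (isLink_K _ _).joined (Or.inl rfl)
      · exact (isLink_K _ _).joined (Or.inr rfl))
  simp only [Set.insert_subset_iff, Set.singleton_subset_iff] at h
  rw [h, Finset.card_pair hby, Finset.card_singleton]
  obtain ⟨r, rfl⟩ := Nat.exists_eq_succ_of_ne_zero a.pos.ne'
  obtain ⟨s, rfl⟩ : ∃ t, s = t + 2 := ⟨s - 2, by omega⟩
  simp only [Nat.succ_eq_add_one, Nat.add_sub_cancel, show s + 2 - 1 = s + 1 by omega]
  push_cast
  field_simp
  ring

/-- The number of spanning trees of `K r s` through two edges that meet in the second part. -/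
lemma ncard_isTreeSet_K_mem_mem_right {a x : Fin r} (b : Fin s) (hax : a ≠ x) :
    ({F | (K r s).IsTreeSet F ∧ s(.inl a, .inr b) ∈ F ∧ s(.inl x, .inr b) ∈ F}.ncard : ℚ) =
      (r : ℚ) ^ (s - 1) * (s : ℚ) ^ (r - 1) *
        ((((r : ℚ) + s - 1) / (r * s)) ^ 2 - ((s : ℚ) - 1) ^ 2 / ((r : ℚ) ^ 2 * (s : ℚ) ^ 2)) := by
  have hne : (s(.inl a, .inr b) : Sym2 (Fin r ⊕ Fin s)) ≠ s(.inl x, .inr b) := by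
    simp [hax]
  have h := ncard_isTreeSet_K_superset {a, x} {b} b.pos.ne'
    (F₀ := {s(.inl a, .inr b), s(.inl x, .inr b)}) (a := a)
    (by simp) (by simp [Set.insert_subset_iff]) (by simp)
    (by rw [Set.ncard_pair hne, Finset.card_pair hax, Finset.card_singleton]) (by
      have hab : (K r s).Joined {s(.inl a, .inr b), s(.inl x, .inr b)} (.inl a) (.inr b) :=
        (isLink_K _ _).joined (Or.inl rfl)
      intro p hp
      simp only [Finset.mem_disjSum, Finset.mem_singleton, Finset.mem_insert] at hp
      obtain ⟨_, rfl | rfl, rfl⟩ | ⟨_, rfl, rfl⟩ := hp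
      · exact .refl _
      · exact hab.trans _ _ _ ((isLink_K _ _).symm.joined (Or.inr rfl))
      · exact hab)
  simp only [Set.insert_subset_iff, Set.singleton_subset_iff] at h
  rw [h, Finset.card_pair hax, Finset.card_singleton]
  obtain ⟨s, rfl⟩ := Nat.exists_eq_succ_of_ne_zero b.pos.ne'
  obtain ⟨r, rfl⟩ : ∃ t, r = t + 2 := ⟨r - 2, by omega⟩
  simp only [Nat.succ_eq_add_one, Nat.add_sub_cancel, show r + 2 - 1 = r + 1 by omega]
  push_cast
  field_simp
  ring

/-- The number of spanning trees of `K r s` through two disjoint edges. With the first edge as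
root, the second one is traversed by the parent map in one of its two directions. -/
lemma ncard_isTreeSet_K_mem_mem_disjoint {a x : Fin r} {b y : Fin s} (hax : a ≠ x) (hby : b ≠ y) :
    ({F | (K r s).IsTreeSet F ∧ s(.inl a, .inr b) ∈ F ∧ s(.inl x, .inr y) ∈ F}.ncard : ℚ) =
      (r : ℚ) ^ (s - 1) * (s : ℚ) ^ (r - 1) *
        ((((r : ℚ) + s - 1) / (r * s)) ^ 2 - 1 / ((r : ℚ) ^ 2 * (s : ℚ) ^ 2)) := by
  have hx : x ∉ ({a} : Finset (Fin r)) := by simpa using hax.symm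
  have hy : y ∉ ({b} : Finset (Fin s)) := by simpa using hby.symm
  have hF₀ : ∀ e ∈ ({s(.inl a, .inr b)} : Set (Sym2 (Fin r ⊕ Fin s))), ∀ x ∈ e,
      x ∈ ({a} : Finset (Fin r)).disjSum {b} := by simp
  have hbij := bijOn_treeOf (completeBipartiteGraph (Fin r) (Fin s))
    (F₀ := {s(.inl a, .inr b)}) (R := Finset.disjSum {a} {b}) (u := .inl a)
    (by simp) (by simp) hF₀ (by simp) (by
      intro x hx
      simp only [Finset.mem_disjSum, Finset.mem_singleton] at hx
      obtain ⟨_, rfl, rfl⟩ | ⟨_, rfl, rfl⟩ := hx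
      · exact .refl _
      · exact (isLink_K _ _).joined rfl)
  set R : Finset (Fin r ⊕ Fin s) := Finset.disjSum {a} {b} with hR
  have hxR : .inl x ∉ R := by simpa [hR] using hx
  have hyR : .inr y ∉ R := by simpa [hR] using hy
  -- The trees are the parent maps that send `y` to `x` (`M₁`) or `x` to `y` (`M₂`).
  let M₁ : Set ({p // p ∉ R} → Fin r ⊕ Fin s) := {h | IsRooted h ∧
    ∀ p : {p // p ∉ R}, (completeBipartiteGraph (Fin r) (Fin s)).Adj p (h p) ∧
          (p.1 = .inr y → h p = .inl x)}
  let M₂ : Set ({p // p ∉ R} → Fin r ⊕ Fin s) := {h | IsRooted h ∧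
    ∀ p : {p // p ∉ R}, (completeBipartiteGraph (Fin r) (Fin s)).Adj p (h p) ∧
          (p.1 = .inl x → h p = .inr y)}
  have hM : {F | (K r s).IsTreeSet F ∧ s(.inl a, .inr b) ∈ F ∧ s(.inl x, .inr y) ∈ F} =
      treeOf {s(.inl a, .inr b)} '' (M₁ ∪ M₂) := by
    ext F
    constructor
    · rintro ⟨hF, hab, hxy⟩
      obtain ⟨h, ⟨hh, hadj⟩, rfl⟩ := hbij.surjOn ⟨hF, by simpa using hab⟩
      refine ⟨h, ?_, rfl⟩
      rcases (mem_treeOf hF₀ ⟨.inl x, hxR⟩ _).1 hxy with h1 | ⟨hq, h1⟩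
      · exact Or.inr ⟨hh, fun p => ⟨hadj p, fun hp => by rwa [show p = ⟨.inl x, hxR⟩ from
          Subtype.ext hp]⟩⟩
      · exact Or.inl ⟨hh, fun p => ⟨hadj p, fun hp => by rwa [show p = ⟨.inr y, hyR⟩ from
          Subtype.ext hp]⟩⟩
    · rintro ⟨h, hh, rfl⟩
      have hF := hbij.mapsTo (show h ∈ {h | _} from
        ⟨hh.elim (·.1) (·.1), fun p => hh.elim (fun h => (h.2 p).1) fun h => (h.2 p).1⟩)
      refine ⟨hF.1, by simpa using hF.2, ?_⟩
      rw [mem_treeOf hF₀ ⟨.inl x, hxR⟩]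
      exact hh.elim (fun h => Or.inr ⟨hyR, (h.2 ⟨_, hyR⟩).2 rfl⟩)
        (fun h => Or.inl ((h.2 ⟨_, hxR⟩).2 rfl))
  have hdisj : Disjoint M₁ M₂ := by
    rw [Set.disjoint_left]
    intro h h1 h2
    exact h1.1.ne (p := ⟨.inl x, hxR⟩) (q := ⟨.inr y, hyR⟩) ((h2.2 ⟨_, hxR⟩).2 rfl)
      ((h1.2 ⟨_, hyR⟩).2 rfl)
  rw [hM, (hbij.injOn.mono ?_).ncard_image, Set.ncard_union_eq hdisj, Nat.cast_add,
    ncard_isRooted_K_parent_inr hx hy, ncard_isRooted_K_parent_inl hx hy]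
  · obtain ⟨r, rfl⟩ : ∃ t, r = t + 2 := ⟨r - 2, by omega⟩
    obtain ⟨s, rfl⟩ : ∃ t, s = t + 2 := ⟨s - 2, by omega⟩
    simp only [Finset.card_singleton, Nat.add_sub_cancel, show r + 2 - 1 = r + 1 by omega,
      show s + 2 - 1 = s + 1 by omega]
    push_cast
    field_simp
    ring
  · rintro h (hh | hh)
    · exact ⟨hh.1, fun p => (hh.2 p).1⟩
    · exact ⟨hh.1, fun p => (hh.2 p).1⟩

end CompleteBipartite

/-! ### Edge types and the assembled count -/

section KeyVertices

variable {n : ℕ} [NeZero n] {α β : Fin n → Type*} {u v : ∀ i, α i}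

/-- Only key vertices of the beads are identified with key vertices. -/
lemma eq_or_eq_of_mk_eq {k i : Fin n} {p : α k} {q : α i} (hq : q = u i ∨ q = v i)
    (h : Quot.mk (Glue u v) ⟨k, p⟩ = Quot.mk (Glue u v) ⟨i, q⟩) : p = u k ∨ p = v k := by
  let c : Quot (Glue u v) → Prop := Quot.lift (fun p => p.2 = u p.1 ∨ p.2 = v p.1) (by
    rintro _ _ ⟨m, rfl, rfl⟩
    simp)
  have := congrArg c h
  exact this.mpr hq

/-- The non-key edges incident with a key vertex are the type 1 edges. -/
lemma isTypeOne_iff {G : ∀ i, Graph (α i) (β i)} {e : ∀ i, β i}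
    (he : ∀ i, (G i).IsLink (e i) (u i) (v i)) {k : Fin n} {f : β k} {p q : α k}
    (hf : (G k).IsLink f p q) (hfe : f ≠ e k) :
    IsTypeOne G u v e ⟨k, f⟩ ↔ p = u k ∨ p = v k ∨ q = u k ∨ q = v k := by
  have hkey : ¬ IsKeyEdge e ⟨k, f⟩ := by
    rintro ⟨i, h⟩
    obtain rfl : k = i := congrArg Sigma.fst h
    exact hfe (by simpa using h)
  have hlf := necklace_isLink (u := u) (v := v) hf
  constructor
  · rintro ⟨-, -, g, ⟨i, rfl⟩, -, w, hw, hw'⟩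
    have hle := necklace_isLink (u := u) (v := v) (he i)
    have hi : ∃ z, (z = u i ∨ z = v i) ∧ w = Quot.mk _ ⟨i, z⟩ := by
      rcases hw'.eq_or_eq_of_isLink hle with h | h
      · exact ⟨_, Or.inl rfl, h⟩
      · exact ⟨_, Or.inr rfl, h⟩
    obtain ⟨z, hz, rfl⟩ := hi
    rcases hw.eq_or_eq_of_isLink hlf with h | h
    · exact (eq_or_eq_of_mk_eq hz h.symm).elim Or.inl fun h => Or.inr (Or.inl h)
    · exact Or.inr (Or.inr (eq_or_eq_of_mk_eq hz h.symm))
  · intro h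
    have hle := necklace_isLink (u := u) (v := v) (he k)
    refine ⟨hlf.edge_mem, hkey, ⟨k, e k⟩, ⟨k, rfl⟩, fun h => hfe (by simpa using h), ?_⟩
    rcases h with rfl | rfl | rfl | rfl
    · exact ⟨_, hlf.inc_left, hle.inc_left⟩
    · exact ⟨_, hlf.inc_left, hle.inc_right⟩
    · exact ⟨_, hlf.inc_right, hle.inc_left⟩
    · exact ⟨_, hlf.inc_right, hle.inc_right⟩

end KeyVertices

/-- The count of spanning trees through a non-key edge `f` of the `k`-th bead, in terms of the
number `P k * M` of spanning trees of that bead through both `f` and its key edge. -/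
lemma numSpanningTreesThrough_of_ncard {n : ℕ} [NeZero n] {r s : Fin n → ℕ}
    (a : ∀ i, Fin (r i)) (b : ∀ i, Fin (s i)) {k : Fin n} {x : Fin (r k)} {y : Fin (s k)}
    (hne : (s(.inl x, .inr y) : Sym2 (Fin (r k) ⊕ Fin (s k))) ≠ s(.inl (a k), .inr (b k)))
    {M : ℚ} (hM : ({F | (K (r k) (s k)).IsTreeSet F ∧ s(.inl (a k), .inr (b k)) ∈ F ∧
      s(.inl x, .inr y) ∈ F}.ncard : ℚ) = (r k : ℚ) ^ (s k - 1) * (s k : ℚ) ^ (r k - 1) * M) :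
    ((necklace (fun i => K (r i) (s i)) (fun i => .inl (a i))
      (fun i => .inr (b i))).numSpanningTreesThrough ⟨k, s(.inl x, .inr y)⟩ : ℚ) =
      (∏ i, (r i : ℚ) ^ (s i - 1) * (s i : ℚ) ^ (r i - 1)) *
        (((r k : ℚ) + s k - 1) / ((r k : ℚ) * s k) *
            ∑ i, ((r i : ℚ) + s i - 1) / ((r i : ℚ) * s i) -
          ((((r k : ℚ) + s k - 1) / ((r k : ℚ) * s k)) ^ 2 - M)) := by
  classical
  set D : Fin n → ℚ := fun i => ((r i : ℚ) + s i - 1) / ((r i : ℚ) * s i) with hD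
  -- The factor of the bead `i` in the summand where the bead `i₀` is disconnected.
  have hfactor : ∀ i₀ i, ({F | (if i = i₀
      then (K (r i) (s i)).IsSplitSet s(.inl (a i), .inr (b i)) F
      else (K (r i) (s i)).IsTreeSet F) ∧ (i = k → (⟨k, s(.inl x, .inr y)⟩ :
        Σ i, Sym2 (Fin (r i) ⊕ Fin (s i))) ∈ Sigma.mk i '' F)}.ncard : ℚ) =
      (r i : ℚ) ^ (s i - 1) * (s i : ℚ) ^ (r i - 1) * if i = i₀
        then if i = k then M else D i else if i = k then D i else 1 := by
    intro i₀ i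
    have : Nonempty (Fin (r i) ⊕ Fin (s i)) := ⟨.inl (a i)⟩
    by_cases hk : i = k
    · subst hk
      simp only [forall_const, if_true, Set.mem_image, Sigma.mk.injEq, heq_eq_eq, true_and,
        exists_eq_right]
      split_ifs with h0
      · rw [← hM, ncard_isSplitSet (mem_edgeSet_K _ _) (fun F => s(.inl x, .inr y) ∈ F)]
        exact fun F => ⟨fun h => h.resolve_left hne, fun h => Or.inr h⟩
      · exact ncard_isTreeSet_K_mem _ _
    · simp only [hk, false_imp_iff, and_true, if_false]
      split_ifs with h0
      · have h := ncard_isSplitSet (mem_edgeSet_K (a i) (b i)) (fun _ => True) (by simp)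
        simp only [and_true] at h
        rw [h]
        exact ncard_isTreeSet_K_mem _ _
      · rw [mul_one]
        exact ncard_isTreeSet_K (a i).pos.ne' (b i).pos.ne'
  rw [numSpanningTreesThrough_necklace (fun i => rfl) (by simp)
    (e := fun i => s(.inl (a i), .inr (b i))) (fun i => isLink_K _ _)]
  push_cast
  simp only [hfactor, Finset.prod_mul_distrib (f := fun i =>
    (r i : ℚ) ^ (s i - 1) * (s i : ℚ) ^ (r i - 1)), ← Finset.mul_sum]
  congr 1
  have hprod : ∀ i₀, ∏ i, (if i = i₀ then if i = k then M else D i else if i = k then D i else 1) =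
      D k * D i₀ - if i₀ = k then D k ^ 2 - M else 0 := by
    intro i₀
    by_cases h0 : i₀ = k
    · subst h0
      have : ∀ i, (if i = i₀ then if i = i₀ then M else D i else if i = i₀ then D i else 1) =
          if i = i₀ then M else 1 := fun i => by split_ifs <;> rfl
      simp only [this, Finset.prod_ite_eq', Finset.mem_univ, if_true]
      ring
    · have : ∀ i, (if i = i₀ then if i = k then M else D i else if i = k then D i else 1) =
          (if i = k then D i else 1) * if i = i₀ then D i else 1 := by
        intro i
        by_cases h1 : i = i₀
        · subst h1
          simp [h0]
        · simp [h1]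
      simp only [this, Finset.prod_mul_distrib, Finset.prod_ite_eq', Finset.mem_univ, if_true, h0,
        if_false, sub_zero]
  simp only [hprod, Finset.sum_sub_distrib, ← Finset.mul_sum, Finset.sum_ite_eq', Finset.mem_univ,
    if_true]
  rfl

end Necklace

theorem mainTheorem2 (n : ℕ) [NeZero n] (r s : Fin n → ℕ)
    (hr : r 0 = 1) (hs : s 0 = 1)
    (a : ∀ i, Fin (r i)) (b : ∀ i, Fin (s i))
    (u v : ∀ i, Fin (r i) ⊕ Fin (s i))
    (hu : ∀ i, u i = Sum.inl (a i)) (hv : ∀ i, v i = Sum.inr (b i))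
    (k : Fin n) (x y : Fin (r k) ⊕ Fin (s k))
    (hxy : s(x, y) ∈ E(Necklace.K (r k) (s k))) :
    let KK := fun i => Necklace.K (r i) (s i)
    let G := Necklace.necklace KK u v
    let key := fun i => s(u i, v i)
    let τ : ℚ := (G.numSpanningTreesThrough ⟨k, s(x, y)⟩ : ℚ)
    let P : ℚ := ∏ i, (r i : ℚ) ^ (s i - 1) * (s i : ℚ) ^ (r i - 1)
    let S : ℚ := ∑ i, ((r i : ℚ) + s i - 1) / ((r i : ℚ) * s i)
    let D : ℚ := ((r k : ℚ) + s k - 1) / ((r k : ℚ) * s k)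
    (Necklace.IsTypeOne KK u v key ⟨k, s(x, y)⟩ →
      (({x, y} ∩ {u k, v k} : Set (Fin (r k) ⊕ Fin (s k))) = {u k} ∨
        ({x, y} ∩ {u k, v k} : Set (Fin (r k) ⊕ Fin (s k))) = {v k}) ∧
      (({x, y} ∩ {u k, v k} : Set (Fin (r k) ⊕ Fin (s k))) = {u k} →
        τ = P * (D * S - ((r k : ℚ) - 1) ^ 2 / ((r k : ℚ) ^ 2 * (s k : ℚ) ^ 2))) ∧
      (({x, y} ∩ {u k, v k} : Set (Fin (r k) ⊕ Fin (s k))) = {v k} →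
        τ = P * (D * S - ((s k : ℚ) - 1) ^ 2 / ((r k : ℚ) ^ 2 * (s k : ℚ) ^ 2)))) ∧
    (Necklace.IsTypeTwo KK u v key ⟨k, s(x, y)⟩ →
      τ = P * (D * S - 1 / ((r k : ℚ) ^ 2 * (s k : ℚ) ^ 2))) := by
  intro KK G key τ P S D
  obtain rfl : u = fun i => .inl (a i) := funext hu
  obtain rfl : v = fun i => .inr (b i) := funext hv
  -- All claims are symmetric in `x` and `y`, so `x` may be taken in the first part.
  wlog hx : x.isLeft generalizing x y with H
  · have hxy' : s(y, x) ∈ E(Necklace.K (r k) (s k)) := by rwa [Sym2.eq_swap]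
    have hy : y.isLeft := by
      have : (completeBipartiteGraph _ _).Adj x y := hxy
      rw [Necklace.adj_iff_isLeft] at this
      simpa [hx] using this
    have h := H y x hxy' hy
    simp only [τ, Set.pair_comm x y, Sym2.eq_swap (a := x) (b := y)]
    exact h
  obtain ⟨x, rfl⟩ := Sum.isLeft_iff.1 hx
  obtain ⟨y, rfl⟩ : ∃ z, y = .inr z := by
    have : (completeBipartiteGraph _ _).Adj (.inl x) y := hxy
    rw [Necklace.adj_iff_isLeft] at this
    exact Sum.isRight_iff.1 (by simpa using this)
  have hkey : (s(.inl x, .inr y) : Sym2 (Fin (r k) ⊕ Fin (s k))) ≠ s(.inl (a k), .inr (b k)) ↔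
      ¬ (x = a k ∧ y = b k) := by simp
  have htype : ¬ (x = a k ∧ y = b k) →
      (Necklace.IsTypeOne KK (fun i => .inl (a i)) (fun i => .inr (b i)) key
        ⟨k, s(.inl x, .inr y)⟩ ↔ x = a k ∨ y = b k) := fun h => by
    rw [Necklace.isTypeOne_iff (fun i => Necklace.isLink_K _ _) (Necklace.isLink_K x y)
      (hkey.2 h)]
    simp
  have hnonkey : ¬ Necklace.IsKeyEdge key ⟨k, s(.inl x, .inr y)⟩ → ¬ (x = a k ∧ y = b k) := by
    rintro h ⟨rfl, rfl⟩
    exact h ⟨k, rfl⟩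
  have hinl : ({.inl x, .inr y} ∩ {.inl (a k), .inr (b k)} :
      Set (Fin (r k) ⊕ Fin (s k))) = {.inl (a k)} ↔ x = a k ∧ y ≠ b k := by
    constructor
    · intro h
      have h1 := Set.ext_iff.1 h (.inl (a k))
      have h2 := Set.ext_iff.1 h (.inr (b k))
      simp at h1 h2
      exact ⟨h1.symm, fun h => h2 h.symm⟩
    · rintro ⟨rfl, hy⟩
      ext (z | z)
      · simp
      · simp only [Set.mem_inter_iff, Set.mem_insert_iff, reduceCtorEq, Set.mem_singleton_iff,
          Sum.inr.injEq, false_or, iff_false]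
        rintro ⟨rfl, h⟩
        exact hy h
  have hinr : ({.inl x, .inr y} ∩ {.inl (a k), .inr (b k)} :
      Set (Fin (r k) ⊕ Fin (s k))) = {.inr (b k)} ↔ y = b k ∧ x ≠ a k := by
    constructor
    · intro h
      have h1 := Set.ext_iff.1 h (.inl (a k))
      have h2 := Set.ext_iff.1 h (.inr (b k))
      simp at h1 h2
      exact ⟨h2.symm, fun h => h1 h.symm⟩
    · rintro ⟨rfl, hx⟩
      ext (z | z)
      · simp only [Set.mem_inter_iff, Set.mem_insert_iff, reduceCtorEq, Set.mem_singleton_iff,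
          Sum.inl.injEq, or_false, iff_false]
        rintro ⟨rfl, h⟩
        exact hx h
      · simp
  refine ⟨fun h => ?_, fun h => ?_⟩
  · have hne := hnonkey h.2.1
    have hxy1 := (htype hne).1 h
    rw [hinl, hinr]
    refine ⟨by tauto, ?_, ?_⟩
    · rintro ⟨rfl, hy⟩
      have := Necklace.numSpanningTreesThrough_of_ncard a b (hkey.2 hne)
        (Necklace.ncard_isTreeSet_K_mem_mem_left (a k) (Ne.symm hy))
      exact this.trans (by simp only [P, D, S]; ring)
    · rintro ⟨rfl, hx⟩
      have := Necklace.numSpanningTreesThrough_of_ncard a b (hkey.2 hne)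
        (Necklace.ncard_isTreeSet_K_mem_mem_right (b k) (Ne.symm hx))
      exact this.trans (by simp only [P, D, S]; ring)
  · have hne := hnonkey h.2.1
    have hxy2 := h.2.2
    rw [htype hne, not_or] at hxy2
    have := Necklace.numSpanningTreesThrough_of_ncard a b (hkey.2 hne)
      (Necklace.ncard_isTreeSet_K_mem_mem_disjoint (Ne.symm hxy2.1) (Ne.symm hxy2.2))
    exact this.trans (by simp only [P, D, S]; ring)
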